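/- **Setting.** An instance of index coding with disjoint helpers (ICDH) with $k$ helpers and $n$ users consists of sets $C_1,\dots,C_k\subseteq\{1,\dots,n\}$ and $S_1,\dots,S_k\subseteq\{1,\dots,n\}$ such that the $C_j$ are pairwise disjoint and $C_j\cap S_j=\emptyset$ for all $j$. User $u$ requests the packet $x_u\in\mathbb F_2$; helper $j$ serves the users in $C_j$ and stores the packets in $S_j$, so user $u$ has the side information $N(u)=\bigcup_{j:\,u\in C_j}S_j$. The undirected side information graph $G$ on $\{1,\dots,n\}$ joins $u\neq v$ iff $v\in N(u)$ and $u\in N(v)$. An XOR coloring scheme of length $t$ is a matrix $(G_{i,u})\in\mathbb F_2^{t\times n}$, with transmissions $y_i=\sum_u G_{i,u}x_u$, such that for every $u$ there is exactly one $i$ with $G_{i,u}\ne0$, and $x_u$ is an $\mathbb F_2$-linear function of that $y_i$ and of the packets in $N(u)$. It is optimal if no XOR coloring scheme has smaller length. The categories for $k$ helpers are the labels $(i,p)$ with $i\in\{1,\dots,k\}$ and $\emptyset\neq p\subseteq\{1,\dots,k\}\setminus\{i\}$; a user $u\in C_i$ belongs to $(i,p)$ iff, for every $j\ne i$, $u$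 has a $G$-neighbour in $C_j$ exactly when $j\in p$. The category graph joins $(i,p)$ and $(j,q)$ iff $j\in p$ and $i\in q$. Let $A$ be the $0/1$ incidence matrix whose rows are the categories and whose columns are the non-empty cliques of the category graph ($A$ depends only on $k$), and let $w(v)$ be the number of users in category $v$. Consider the integer program $$\min \mathbf 1^{T}c\quad\text{subject to}\quad Ac=w,\ c\ge 0,\ c\ \text{integral.}\tag{IP}$$ The Graver basis of $A$ is the set of minimal elements of $\{g\in\ker A \text{ integral},\ g\neq0\}$ for the order $g\sqsubseteq h$: $g_ih_i\ge0$ and $|g_i|\le|h_i|$ for all $i$. A Graver augmentation of a feasible $c$ replaces $c$ by $c+g\ge0$ with $g$ in the Graver basis and $\mathbf 1^Tg<0$. **Theorem.** For every fixed $k$ there is an algorithm (a program of a random access machine with logarithmic cost) which, given any ICDH instance with $k$ helpers and $n$ users, as the table of the $2kn$ bits $[u\in C_j]$, $[u\in S_j]$, computes in time $O(n\log n)$ (the constant depending on $k$ only): 1. an optimal solution $c$ of (IP), obtained by successive Graver augmentations from the initial feasible solution with $c(\{v\})=w(v)$ and $c(S)=0$ for all other cliques $S$; and 2. an optimal XOR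 coloring scheme, given by its length $t$ and, for each user, the index of the unique transmission in which its packet takes part. Moreover the scheme comes from $c$: for each clique $S$, exactly $c(S)$ transmissions are such that the set of the categories of the participating users is $S$; and $t=d+\mathbf 1^Tc$, where $d$ is the number of isolated vertices of $G$ (whose users belong to no category). -/

import Mathlib

open scoped Matrix

/-! ### Random access machine with logarithmic cost -/

namespace RAM

/-- A machine state: registers and memory, both holding natural numbers. -/
structure State where
  reg : ℕ → ℕ
  mem : ℕ → ℕ

/-- Programs of a random access machine with structured control flow. The arithmetic instructions
are addition and truncated subtraction only; `load` and `store` address the memory indirectly. -/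
inductive Program where
  | skip : Program
  | const (r a : ℕ) : Program
  | add (r s t : ℕ) : Program
  | sub (r s t : ℕ) : Program
  | load (r s : ℕ) : Program
  | store (r s : ℕ) : Program
  | seq (P Q : Program) : Program
  | ifNonzero (r : ℕ) (P Q : Program) : Program
  | whileNonzero (r : ℕ) (P : Program) : Program

def State.setReg (σ : State) (r a : ℕ) : State := ⟨Function.update σ.reg r a, σ.mem⟩

def State.setMem (σ : State) (p a : ℕ) : State := ⟨σ.reg, Function.update σ.mem p a⟩

/-- Logarithmic cost of handling the number `a`: its bit length, plus one. -/
def bitCost (a : ℕ) : ℕ := Nat.size a + 1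

/-- `Exec P σ τ c`: the program `P`, started in state `σ`, halts in state `τ`, and the bit cost of
the execution is `c`. Every instruction is charged the bit length of all the values and all the
memory addresses that it handles. -/
inductive Exec : Program → State → State → ℕ → Prop where
  | skip (σ) : Exec .skip σ σ 1
  | const (σ) (r a) : Exec (.const r a) σ (σ.setReg r a) (bitCost a)
  | add (σ) (r s t) : Exec (.add r s t) σ (σ.setReg r (σ.reg s + σ.reg t))
      (bitCost (σ.reg s) + bitCost (σ.reg t))
  | sub (σ) (r s t) : Exec (.sub r s t) σ (σ.setReg r (σ.reg s - σ.reg t))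
      (bitCost (σ.reg s) + bitCost (σ.reg t))
  | load (σ) (r s) : Exec (.load r s) σ (σ.setReg r (σ.mem (σ.reg s)))
      (bitCost (σ.reg s) + bitCost (σ.mem (σ.reg s)))
  | store (σ) (r s) : Exec (.store r s) σ (σ.setMem (σ.reg r) (σ.reg s))
      (bitCost (σ.reg r) + bitCost (σ.reg s))
  | seq {P Q σ τ ρ c d} (hP : Exec P σ τ c) (hQ : Exec Q τ ρ d) : Exec (.seq P Q) σ ρ (c + d)
  | ifTrue {r P Q σ τ c} (hr : σ.reg r ≠ 0) (hP : Exec P σ τ c) :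
      Exec (.ifNonzero r P Q) σ τ (bitCost (σ.reg r) + c)
  | ifFalse {r P Q σ τ c} (hr : σ.reg r = 0) (hQ : Exec Q σ τ c) :
      Exec (.ifNonzero r P Q) σ τ (bitCost (σ.reg r) + c)
  | whileStep {r P σ τ ρ c d} (hr : σ.reg r ≠ 0) (hP : Exec P σ τ c)
      (hW : Exec (.whileNonzero r P) τ ρ d) :
      Exec (.whileNonzero r P) σ ρ (bitCost (σ.reg r) + c + d)
  | whileDone {r P σ} (hr : σ.reg r = 0) :
      Exec (.whileNonzero r P) σ σ (bitCost (σ.reg r))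

end RAM

/-! ### Index coding with disjoint helpers -/

/-- An instance with `k` helpers and `n` users, user `u` requesting packet `u`: helper `j` is
connected to the users in `C j` and stores the packets in `S j`. The neighbourhoods are pairwise
disjoint, and no user finds its request at its helper. -/
structure ICDH (k n : ℕ) where
  C : Fin k → Finset (Fin n)
  S : Fin k → Finset (Fin n)
  disjoint_C : ∀ i j, i ≠ j → Disjoint (C i) (C j)
  cache_miss : ∀ j, Disjoint (C j) (S j)

namespace ICDH

variable {k n : ℕ}

/-- The packets available to user `u`: the union of the caches of the helpers it is connected to. -/
def sideInfo (I : ICDH k n) (u : Fin n) : Set (Fin n) := {x | ∃ j, u ∈ I.C j ∧ x ∈ I.S j}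

/-- The directed side information graph; the out-neighbourhood of `u` is its side information. -/
def sideInfoGraph (I : ICDH k n) : Digraph (Fin n) where
  Adj u v := v ∈ I.sideInfo u

/-- The underlying undirected side information graph, which keeps the bidirected edges only. -/
def graph (I : ICDH k n) : SimpleGraph (Fin n) where
  Adj u v := u ≠ v ∧ I.sideInfoGraph.Adj u v ∧ I.sideInfoGraph.Adj v u
  symm := ⟨fun _ _ h => ⟨h.1.symm, h.2.2, h.2.1⟩⟩
  loopless := ⟨fun _ h => h.1 rfl⟩

/-- XOR coloring scheme of length `t` with encoding functions `y i = ∑ u, G i u * x u` over `𝔽₂`: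
every packet takes part in exactly one transmission, and every user recovers its packet by a linear
decoding function from that transmission and its side information. -/
structure IsXORColoringScheme (I : ICDH k n) {t : ℕ} (G : Matrix (Fin t) (Fin n) (ZMod 2)) :
    Prop where
  unique : ∀ u, ∃! i, G i u ≠ 0
  decode : ∀ u i, G i u ≠ 0 → ∃ φ : (ZMod 2 × (I.sideInfo u → ZMod 2)) →ₗ[ZMod 2] ZMod 2,
    ∀ x : Fin n → ZMod 2, x u = φ ((G *ᵥ x) i, fun v => x v)

/-- A shortest XOR coloring scheme. -/
def IsOptimalXORColoringScheme (I : ICDH k n) {t : ℕ} (G : Matrix (Fin t) (Fin n) (ZMod 2)) :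
    Prop :=
  I.IsXORColoringScheme G ∧
    ∀ (t' : ℕ) (G' : Matrix (Fin t') (Fin n) (ZMod 2)), I.IsXORColoringScheme G' → t ≤ t'

/-- The encoding matrix in which packet `u` takes part in transmission number `col u` only. -/
def encodingMatrix (n t : ℕ) (col : ℕ → ℕ) : Matrix (Fin t) (Fin n) (ZMod 2) :=
  fun i u => if col u = i then 1 else 0

/-- The users without neighbours in the undirected side information graph. -/
noncomputable def isolatedUsers (I : ICDH k n) : Finset (Fin n) :=
  open Classical in Finset.univ.filter fun u => ∀ v, ¬ I.graph.Adj u v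

/-! ### Category graph and integer program -/

/-- The category labels for `k` helpers: the pair `(i, p)` with `i ∉ p ≠ ∅` is the label of the
vertices in partition `i` that have neighbours in the partitions in `p` and in no others. -/
abbrev Category (k : ℕ) : Type :=
  {v : Fin k × Finset (Fin k) // v.2.Nonempty ∧ v.1 ∉ v.2}

/-- User `u` belongs to category `v`. -/
def InCategory (I : ICDH k n) (u : Fin n) (v : Category k) : Prop :=
  u ∈ I.C v.1.1 ∧ ∀ j, j ≠ v.1.1 → (j ∈ v.1.2 ↔ ∃ u' ∈ I.C j, I.graph.Adj u u')

/-- The number of users in category `v`. -/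
noncomputable def weight (I : ICDH k n) (v : Category k) : ℤ :=
  open Classical in ((Finset.univ.filter fun u => I.InCategory u v).card : ℤ)

/-- The category graph: `(i, p)` and `(j, q)` are adjacent iff `j ∈ p` and `i ∈ q`. -/
def categoryGraph (k : ℕ) : SimpleGraph (Category k) where
  Adj v w := w.1.1 ∈ v.1.2 ∧ v.1.1 ∈ w.1.2
  symm := ⟨fun _ _ h => ⟨h.2, h.1⟩⟩
  loopless := ⟨fun v h => v.2.2 h.1⟩

/-- The (non-empty) cliques of the category graph. -/
abbrev Clique (k : ℕ) : Type :=
  {S : Finset (Category k) // S.Nonempty ∧ (categoryGraph k).IsClique (S : Set (Category k))}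

noncomputable instance (k : ℕ) : Fintype (Clique k) := Fintype.ofFinite _

/-- The constraint matrix: the incidence matrix of category labels and cliques. -/
def constraintMatrix (k : ℕ) : Matrix (Category k) (Clique k) ℤ :=
  fun v S => if v ∈ S.1 then 1 else 0

/-- `c` is feasible for the integer program: `A c = w`, `c ≥ 0`. -/
def IsFeasible (I : ICDH k n) (c : Clique k → ℤ) : Prop :=
  constraintMatrix k *ᵥ c = I.weight ∧ 0 ≤ c

/-- `c` is an optimal solution of: minimize `1ᵀ c` subject to `A c = w`, `c ≥ 0`, `c` integral. -/
def IsOptimalSolution (I : ICDH k n) (c : Clique k → ℤ) : Prop :=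
  I.IsFeasible c ∧ ∀ c', I.IsFeasible c' → ∑ S, c S ≤ ∑ S, c' S

/-- The feasible solution with `c({v}) = w(v)`, and `c(S) = 0` for the other cliques. -/
noncomputable def initialSolution (I : ICDH k n) (S : Clique k) : ℤ :=
  if S.1.card = 1 then ∑ v ∈ S.1, I.weight v else 0

/-! ### Graver basis -/

/-- `g` is conformal to `h`: same orthant, and dominated by it in absolute value. -/
def Conformal {ι : Type*} (g h : ι → ℤ) : Prop := ∀ i, 0 ≤ g i * h i ∧ |g i| ≤ |h i|

/-- The Graver basis: the conformally minimal nonzero integral vectors in the kernel of `A`. -/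
def graverBasis {μ ι : Type*} [Fintype ι] (A : Matrix μ ι ℤ) : Set (ι → ℤ) :=
  {g | (A *ᵥ g = 0 ∧ g ≠ 0) ∧ ∀ h, (A *ᵥ h = 0 ∧ h ≠ 0) → Conformal h g → h = g}

/-- One augmentation step: adding an element of the Graver basis that keeps the solution
nonnegative and decreases the objective. -/
def Augments (c c' : Clique k → ℤ) : Prop :=
  ∃ g ∈ graverBasis (constraintMatrix k), ∑ S, g S < 0 ∧ c' = c + g ∧ 0 ≤ c'

/-! ### Input and output of the algorithm -/

/-- The input: register `0` holds `n`; in memory, user `u` has a block of `2k` cells, which hold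
the `k` bits `u ∈ C j` and then the `k` bits `u ∈ S j`. All else is `0`. -/
def input (I : ICDH k n) : RAM.State where
  reg r := if r = 0 then n else 0
  mem p :=
    if ∃ (u : Fin n) (j : Fin k),
        (p = 2 * k * u + j ∧ u ∈ I.C j) ∨ (p = 2 * k * u + k + j ∧ u ∈ I.S j) then 1 else 0

end ICDH

/-! ### Adjacency of users through their categories -/

namespace ICDH

variable {k n : ℕ}

/-! Whether two users are adjacent depends only on their categories (`adj_iff_inCategory`): apart
from its isolated vertices, `G` is the blow-up of the category graph in which each category is
replaced by an independent set. Over `𝔽₂` an XOR coloring scheme is the same thing as a partition of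
the users into cliques (`isXORColoringScheme_iff`). In such a partition every isolated user is
alone, and any other class meets each category at most once, so it projects injectively onto a
clique of the category graph. Counting the classes over each clique gives a feasible point of (IP),
hence the lower bound `d + 1ᵀc` (`IsOptimalSolution.card_add_sum_le`).

Conversely, given `c`, reserve `c S` transmissions for each clique `S` and send the users of
category `v` injectively to the transmissions of the cliques containing `v`. Since `Ac = w`, there
are exactly as many places as users, so every place is filled and the bound is attained
(`IsSchedule.exists_user`, `IsSchedule.isOptimalXORColoringScheme`). A greedy placement never gets
stuck, because the free places of `v` always number the users of `v` still to come
(`Progress.exists_rem_ne_zero`).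

For (IP), the difference between a better feasible point and `c` is a kernel vector of negative
objective. It dominates conformally a Graver element of negative objective
(`exists_graverBasis_conformal`), which can be added to `c` without leaving the orthant. The Graver
basis is finite (`graverBasis_finite`) and depends on `k` only. The initial objective is at most `n`
(`IsFeasible.sum_le`) and each augmentation lowers it by at least one, so there are at most `n`
augmentations.

The running time rests on the fact that everything depending on `k` alone (categories, cliques,
Graver basis) is built into the program, which has a fixed set of registers. What remains is four
loops of `O(n)` passes, each pass a piece of loop-free code on numbers that are `O(n)` and so of
logarithmic cost (`Computes.while`). Linear time is possible because the category of a user is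
determined by its own `2k` bits and a table of `k²` bits common to all users (`inCategory_iff`), so
no pairs of users need to be compared. -/

/-- Distinctness of the two users comes for free: if they coincided, that user would request a
packet stored at its own helper. -/
theorem graph_adj_iff (I : ICDH k n) {u u' : Fin n} :
    I.graph.Adj u u' ↔ ∃ i j, u ∈ I.C i ∧ u' ∈ I.C j ∧ u' ∈ I.S i ∧ u ∈ I.S j := by
  constructor
  · rintro ⟨-, ⟨i, hi, hi'⟩, ⟨j, hj, hj'⟩⟩
    exact ⟨i, j, hi, hj, hi', hj'⟩
  · rintro ⟨i, j, hi, hj, hi', hj'⟩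
    refine ⟨?_, ⟨i, hi, hi'⟩, ⟨j, hj, hj'⟩⟩
    rintro rfl
    exact Finset.disjoint_left.1 (I.cache_miss i) hi hi'

theorem eq_of_mem_C (I : ICDH k n) {u : Fin n} {i j : Fin k} (hi : u ∈ I.C i) (hj : u ∈ I.C j) :
    i = j := by
  by_contra h
  exact Finset.disjoint_left.1 (I.disjoint_C i j h) hi hj

open Classical in
/-- The category of a user in the neighbourhoods of the helpers in `C` whose packet is stored by the
helpers in `S`, where `F` holds the pairs `(i, j)` such that helper `i` stores the packet of some
user of helper `j`. -/
noncomputable def bitCategory (C S : Finset (Fin k)) (F : Finset (Fin k × Fin k)) :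
    Option (Category k) :=
  if h : ∃ v : Category k, v.1.1 ∈ C ∧ v.1.2 = S.filter fun j => (v.1.1, j) ∈ F then
    some h.choose else none

/-- The pairs `(i, j)` such that helper `i` stores the packet of some user of helper `j`. -/
def linkedPairs (I : ICDH k n) : Finset (Fin k × Fin k) :=
  Finset.univ.filter fun q => ∃ u, u ∈ I.C q.2 ∧ u ∈ I.S q.1

/-- The category of a user; `none` for users without neighbours. -/
noncomputable def userCategory (I : ICDH k n) (u : Fin n) : Option (Category k) :=
  bitCategory (Finset.univ.filter fun j => u ∈ I.C j) (Finset.univ.filter fun j => u ∈ I.S j)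
    I.linkedPairs

/-- Disjointness of the `C j` fixes the helpers on both sides of an edge, so the search for a
neighbour splits into a bit of `u` and a bit of the pair of helpers, the latter independent of `u`.
The restriction `j ≠ v.1.1` can be dropped, since the cache miss condition makes the right side
false there. -/
theorem inCategory_iff (I : ICDH k n) {u : Fin n} {v : Category k} :
    I.InCategory u v ↔
      u ∈ I.C v.1.1 ∧ ∀ j, j ∈ v.1.2 ↔ u ∈ I.S j ∧ ∃ u' ∈ I.C j, u' ∈ I.S v.1.1 := by
  have key : ∀ j, u ∈ I.C v.1.1 →
      ((∃ u' ∈ I.C j, I.graph.Adj u u') ↔ u ∈ I.S j ∧ ∃ u' ∈ I.C j, u' ∈ I.S v.1.1) := by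
    intro j hu
    constructor
    · rintro ⟨u', hu', h⟩
      obtain ⟨i, j', h1, h2, h3, h4⟩ := I.graph_adj_iff.1 h
      rw [I.eq_of_mem_C hu' h2, I.eq_of_mem_C hu h1]
      exact ⟨h4, u', h2, h3⟩
    · rintro ⟨h1, u', h2, h3⟩
      exact ⟨u', h2, I.graph_adj_iff.2 ⟨_, _, hu, h2, h3, h1⟩⟩
  constructor
  · rintro ⟨hu, h⟩
    refine ⟨hu, fun j => ?_⟩
    by_cases hj : j = v.1.1
    · subst hj
      exact iff_of_false v.2.2 fun h' => Finset.disjoint_left.1 (I.cache_miss _) hu h'.1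
    · rw [h j hj, key j hu]
  · rintro ⟨hu, h⟩
    exact ⟨hu, fun j _ => by rw [h j, key j hu]⟩

theorem InCategory.unique {I : ICDH k n} {u : Fin n} {v w : Category k} (hv : I.InCategory u v)
    (hw : I.InCategory u w) : v = w := by
  rw [inCategory_iff] at hv hw
  have h := I.eq_of_mem_C hv.1 hw.1
  refine Subtype.ext (Prod.ext h (Finset.ext fun j => ?_))
  rw [hv.2, hw.2, h]

theorem userCategory_eq_some (I : ICDH k n) {u : Fin n} {v : Category k} :
    I.userCategory u = some v ↔ I.InCategory u v := by
  classical
  have key : ∀ v : Category k, (v.1.1 ∈ (Finset.univ.filter fun j => u ∈ I.C j) ∧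
      v.1.2 = (Finset.univ.filter fun j => u ∈ I.S j).filter
        fun j => (v.1.1, j) ∈ I.linkedPairs) ↔ I.InCategory u v := by
    intro v
    rw [inCategory_iff]
    simp [linkedPairs, Finset.ext_iff]
  unfold userCategory bitCategory
  split_ifs with h
  -- The chosen category is one that fits `u`; by uniqueness it is the only one.
  · have h' := (key _).1 h.choose_spec
    rw [Option.some_inj]
    exact ⟨fun e => e ▸ h', fun e => h'.unique e⟩
  · simp only [false_iff]
    exact fun h' => h ⟨v, (key v).2 h'⟩

/-- The blow-up structure of `G`. An edge itself witnesses that each endpoint's label contains the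
helper of the other endpoint, so both labels are non-empty. Conversely, adjacent labels supply both
stored packets without reference to any further users. -/
theorem adj_iff_inCategory (I : ICDH k n) {u u' : Fin n} : I.graph.Adj u u' ↔
    ∃ v v', I.InCategory u v ∧ I.InCategory u' v' ∧ (categoryGraph k).Adj v v' := by
  classical
  constructor
  · intro h
    obtain ⟨i, j, hi, hj, hi', hj'⟩ := I.graph_adj_iff.1 h
    let p : Finset (Fin k) := Finset.univ.filter fun j => u ∈ I.S j ∧ ∃ x ∈ I.C j, x ∈ I.S i
    let q : Finset (Fin k) := Finset.univ.filter fun i => u' ∈ I.S i ∧ ∃ x ∈ I.C i, x ∈ I.S j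
    have hp : j ∈ p := by simpa [p] using ⟨hj', u', hj, hi'⟩
    have hq : i ∈ q := by simpa [q] using ⟨hi', u, hi, hj'⟩
    have hip : i ∉ p := fun h' =>
      Finset.disjoint_left.1 (I.cache_miss i) hi (Finset.mem_filter.1 h').2.1
    have hjq : j ∉ q := fun h' =>
      Finset.disjoint_left.1 (I.cache_miss j) hj (Finset.mem_filter.1 h').2.1
    refine ⟨⟨(i, p), ⟨j, hp⟩, hip⟩, ⟨(j, q), ⟨i, hq⟩, hjq⟩, ?_, ?_, hp, hq⟩
    · rw [inCategory_iff]; exact ⟨hi, by simp [p]⟩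
    · rw [inCategory_iff]; exact ⟨hj, by simp [q]⟩
  · rintro ⟨v, v', hv, hv', h1, h2⟩
    rw [inCategory_iff] at hv hv'
    exact I.graph_adj_iff.2 ⟨_, _, hv.1, hv'.1, ((hv'.2 _).1 h2).1, ((hv.2 _).1 h1).1⟩

theorem userCategory_eq_none (I : ICDH k n) {u : Fin n} :
    I.userCategory u = none ↔ ∀ u', ¬ I.graph.Adj u u' := by
  constructor
  · intro h u' hu'
    obtain ⟨v, v', hv, -⟩ := I.adj_iff_inCategory.1 hu'
    rw [I.userCategory_eq_some.2 hv] at h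
    cases h
  · intro h
    by_contra h'
    obtain ⟨v, hv⟩ := Option.ne_none_iff_exists'.1 h'
    have hv' := I.userCategory_eq_some.1 hv
    obtain ⟨j, hj⟩ := v.2.1
    have hne : j ≠ v.1.1 := fun e => v.2.2 (e ▸ hj)
    obtain ⟨u', -, hu'⟩ := (hv'.2 j hne).1 hj
    exact h u' hu'

theorem isolatedUsers_eq (I : ICDH k n) :
    I.isolatedUsers = Finset.univ.filter fun u => I.userCategory u = none := by
  ext u
  simp [isolatedUsers, userCategory_eq_none]

theorem weight_eq (I : ICDH k n) (v : Category k) :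
    I.weight v = (Finset.univ.filter fun u => I.userCategory u = some v).card := by
  unfold weight
  simp only [Nat.cast_inj]
  congr 1
  ext u
  simp [userCategory_eq_some]

/-! ### Conformal order and finiteness of the Graver basis -/

/-- In each coordinate `g` lies between `0` and `h`, hence so does `h - g`. A conformal summand thus
has a conformal complement. -/
theorem Conformal.sub {ι : Type*} {g h : ι → ℤ} (hc : Conformal g h) : Conformal (h - g) h := by
  intro i
  obtain ⟨h1, h2⟩ := hc i
  simp only [Pi.sub_apply]
  rcases le_total 0 (h i) with hh | hh
  · rw [abs_of_nonneg hh] at h2 ⊢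
    rcases hh.eq_or_lt with h0 | h0
    · rw [← h0] at h2 ⊢
      have : g i = 0 := by simpa using h2
      simp [this]
    · have hg : 0 ≤ g i := nonneg_of_mul_nonneg_left h1 h0
      rw [abs_of_nonneg hg] at h2
      rw [abs_of_nonneg (by linarith)]
      exact ⟨mul_nonneg (by linarith) hh, by linarith⟩
  · rw [abs_of_nonpos hh] at h2 ⊢
    rcases hh.eq_or_lt with h0 | h0
    · rw [h0] at h2 ⊢
      have : g i = 0 := by simpa using h2
      simp [this]
    · have hg : g i ≤ 0 := by
        by_contra hg
        push Not at hg
        nlinarith [mul_pos hg (neg_pos.2 h0)]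
      rw [abs_of_nonpos hg] at h2
      rw [abs_of_nonpos (by linarith)]
      exact ⟨mul_nonneg_of_nonpos_of_nonpos (by linarith) hh, by linarith⟩

theorem Conformal.trans {ι : Type*} {f g h : ι → ℤ} (h1 : Conformal f g) (h2 : Conformal g h) :
    Conformal f h := by
  intro i
  obtain ⟨a1, a2⟩ := h1 i
  obtain ⟨b1, b2⟩ := h2 i
  refine ⟨?_, a2.trans b2⟩
  rcases eq_or_ne (g i) 0 with h0 | h0
  · rw [h0] at a2
    have : f i = 0 := by simpa using a2
    simp [this]
  · have := mul_nonneg a1 b1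
    have h3 : 0 < g i * g i := mul_self_pos.2 h0
    exact nonneg_of_mul_nonneg_left (by linarith [this, mul_comm (f i * g i) (g i * h i)] :
      0 ≤ (f i * h i) * (g i * g i)) h3

/-- The ℓ¹ norm is the induction measure for conformal decompositions. -/
theorem Conformal.natAbs_sum_lt {ι : Type*} [Fintype ι] {g h : ι → ℤ} (hc : Conformal g h)
    (hne : g ≠ h) : ∑ i, (g i).natAbs < ∑ i, (h i).natAbs := by
  obtain ⟨i, hi⟩ := Function.ne_iff.1 hne
  refine Finset.sum_lt_sum (fun i _ => ?_) ⟨i, Finset.mem_univ i, ?_⟩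
  · have := (hc i).2
    rw [Int.abs_eq_natAbs, Int.abs_eq_natAbs] at this
    omega
  · obtain ⟨h1, h2⟩ := hc i
    by_contra hlt
    have habs : |g i| = |h i| := by
      rw [Int.abs_eq_natAbs, Int.abs_eq_natAbs] at h2 ⊢
      omega
    rcases abs_eq_abs.1 habs with h3 | h3
    · exact hi h3
    · rw [h3] at h1
      have : h i = 0 := by nlinarith [mul_self_nonneg (h i)]
      rw [this] at h3
      exact hi (by rw [h3, this]; simp)

/-- A kernel vector with negative objective dominates a Graver basis element with negative
objective. -/
theorem exists_graverBasis_conformal {μ ι : Type*} [Fintype ι] (A : Matrix μ ι ℤ) (h : ι → ℤ)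
    (hA : A *ᵥ h = 0) (hneg : ∑ i, h i < 0) :
    ∃ g ∈ graverBasis A, Conformal g h ∧ ∑ i, g i < 0 := by
  induction hN : ∑ i, (h i).natAbs using Nat.strong_induction_on generalizing h with
  | _ N ih =>
  have hne : h ≠ 0 := by
    rintro rfl
    simp at hneg
  by_cases hg : h ∈ graverBasis A
  · exact ⟨h, hg, fun i => ⟨mul_self_nonneg _, le_rfl⟩, hneg⟩
  · have : ∃ f, (A *ᵥ f = 0 ∧ f ≠ 0) ∧ Conformal f h ∧ f ≠ h := by
      by_contra! hcon
      exact hg ⟨⟨hA, hne⟩, fun f hf hc => hcon f hf hc⟩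
    obtain ⟨f, ⟨hf, hf0⟩, hc, hfh⟩ := this
    -- `h = f + (h - f)` is a conformal splitting inside the kernel with both parts of smaller norm.
    -- The objectives add up to a negative number, so the induction applies to one of the parts.
    by_cases hs : ∑ i, f i < 0
    · obtain ⟨g, h1, h2, h3⟩ := ih _ (hN ▸ hc.natAbs_sum_lt hfh) f hf hs rfl
      exact ⟨g, h1, h2.trans hc, h3⟩
    · have hsub : Conformal (h - f) h := hc.sub
      obtain ⟨g, h1, h2, h3⟩ := ih _
        (hN ▸ hsub.natAbs_sum_lt (by simpa using hf0)) (h - f)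
        (by rw [Matrix.mulVec_sub, hA, hf, sub_zero])
        (by simp only [Pi.sub_apply, Finset.sum_sub_distrib]; linarith) rfl
      exact ⟨g, h1, h2.trans hsub, h3⟩

/-- The Graver basis is finite, by Dickson's lemma. -/
theorem graverBasis_finite {μ ι : Type*} [Fintype ι] (A : Matrix μ ι ℤ) :
    (graverBasis A).Finite := by
  -- Splitting into positive and negative parts turns the componentwise order of natural vectors
  -- into conformality, so minimality makes the image of the Graver basis an antichain.
  let Φ : (ι → ℤ) → (ι ⊕ ι → ℕ) := fun g => Sum.elim (fun i => (g i).toNat) fun i => (-g i).toNat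
  have hconf : ∀ g h, Φ g ≤ Φ h → Conformal g h := by
    intro g h hle i
    have h1 : (g i).toNat ≤ (h i).toNat := hle (Sum.inl i)
    have h2 : (-g i).toNat ≤ (-h i).toNat := hle (Sum.inr i)
    refine ⟨?_, by rw [Int.abs_eq_natAbs, Int.abs_eq_natAbs]; omega⟩
    rcases le_total 0 (g i) with hg | hg
    · rcases hg.eq_or_lt with h0 | h0
      · simp [← h0]
      · exact mul_nonneg hg (by omega)
    · rcases hg.eq_or_lt with h0 | h0
      · simp [h0]
      · exact mul_nonneg_of_nonpos_of_nonpos hg (by omega)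
  have hanti : IsAntichain (· ≤ ·) (Φ '' graverBasis A) := by
    rintro _ ⟨g, hg, rfl⟩ _ ⟨h, hh, rfl⟩ hne hle
    exact hne (by rw [hh.2 g hg.1 (hconf g h hle)])
  have hfin : (Φ '' graverBasis A).Finite :=
    hanti.finite_of_partiallyWellOrderedOn (Set.isPWO_of_wellQuasiOrderedLE _)
  refine hfin.of_finite_image ?_
  intro g hg h hh hgh
  exact hh.2 g hg.1 (hconf g h hgh.le)

/-! ### Graver augmentation of feasible solutions -/

/-- A Graver element conformal to `c' - c` moves each coordinate of `c` towards that of `c'` without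
passing it, so the sum stays nonnegative. -/
theorem IsFeasible.exists_augment {I : ICDH k n} {c c' : Clique k → ℤ} (hc : I.IsFeasible c)
    (hc' : I.IsFeasible c') (hlt : ∑ S, c' S < ∑ S, c S) :
    ∃ g ∈ graverBasis (constraintMatrix k), ∑ S, g S < 0 ∧ 0 ≤ c + g := by
  obtain ⟨g, hg, hconf, hneg⟩ := exists_graverBasis_conformal (constraintMatrix k) (c' - c)
    (by rw [Matrix.mulVec_sub, hc.1, hc'.1, sub_self])
    (by simp only [Pi.sub_apply, Finset.sum_sub_distrib]; linarith)
  refine ⟨g, hg, hneg, fun S => ?_⟩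
  obtain ⟨h1, h2⟩ := hconf S
  have h3 := hc.2 S
  have h4 := hc'.2 S
  simp only [Pi.sub_apply, Pi.zero_apply, Pi.add_apply] at *
  by_contra hlt
  have hgn : g S < 0 := by omega
  have : c' S - c S ≤ 0 := by
    by_contra hpos
    push Not at hpos
    nlinarith [mul_pos hpos (neg_pos.2 hgn)]
  rw [abs_of_neg hgn, abs_of_nonpos this] at h2
  omega

theorem Augments.isFeasible {I : ICDH k n} {c c' : Clique k → ℤ} (h : Augments c c')
    (hc : I.IsFeasible c) : I.IsFeasible c' := by
  obtain ⟨g, hg, -, rfl, h0⟩ := h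
  exact ⟨by rw [Matrix.mulVec_add, hc.1, hg.1.1, add_zero], h0⟩

/-- The Graver basis is a test set: a local optimum with respect to it is global. This justifies the
stopping rule of the augmentation loop. -/
theorem isOptimalSolution_of_forall_not_augments {I : ICDH k n} {c : Clique k → ℤ}
    (hc : I.IsFeasible c) (h : ∀ c', ¬ Augments c c') : I.IsOptimalSolution c := by
  refine ⟨hc, fun c' hc' => ?_⟩
  by_contra! hlt
  obtain ⟨g, hg, hneg, h0⟩ := hc.exists_augment hc' hlt
  exact h _ ⟨g, hg, hneg, rfl, h0⟩

/-- The clique that consists of the category `v` only. -/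
def singletonClique (v : Category k) : Clique k := ⟨{v}, by simp⟩

theorem initialSolution_singletonClique (I : ICDH k n) (v : Category k) :
    I.initialSolution (singletonClique v) = I.weight v := by
  simp [initialSolution, singletonClique]

theorem initialSolution_eq_zero (I : ICDH k n) {S : Clique k} (hS : ∀ v, S ≠ singletonClique v) :
    I.initialSolution S = 0 := by
  rw [initialSolution, if_neg]
  intro h
  obtain ⟨v, hv⟩ := Finset.card_eq_one.1 h
  exact hS v (Subtype.ext hv)

theorem singletonClique_injective : Function.Injective (singletonClique (k := k)) := by
  intro v w h
  simpa [singletonClique] using h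

theorem sum_mul_initialSolution (I : ICDH k n) (f : Clique k → ℤ) :
    ∑ S, f S * I.initialSolution S = ∑ v, f (singletonClique v) * I.weight v := by
  classical
  have h1 : ∑ S ∈ Finset.univ.image (singletonClique (k := k)), f S * I.initialSolution S
      = ∑ S, f S * I.initialSolution S := by
    refine Finset.sum_subset (Finset.subset_univ _) fun S _ hS => ?_
    rw [initialSolution_eq_zero, mul_zero]
    rintro v rfl
    exact hS (Finset.mem_image_of_mem _ (Finset.mem_univ v))
  rw [← h1, Finset.sum_image singletonClique_injective.injOn]
  simp only [initialSolution_singletonClique]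

theorem isFeasible_initialSolution (I : ICDH k n) : I.IsFeasible I.initialSolution := by
  classical
  constructor
  · ext v
    simp only [Matrix.mulVec, dotProduct]
    rw [I.sum_mul_initialSolution]
    simp [constraintMatrix, singletonClique, Finset.sum_ite_eq]
  · intro S
    by_cases h : ∃ v, S = singletonClique v
    · obtain ⟨v, rfl⟩ := h
      rw [initialSolution_singletonClique]
      simp [weight]
    · push Not at h
      rw [I.initialSolution_eq_zero h]
      rfl

/-! ### XOR coloring schemes as clique covers -/

theorem not_mem_sideInfo_self (I : ICDH k n) (u : Fin n) : u ∉ I.sideInfo u := by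
  rintro ⟨j, h1, h2⟩
  exact Finset.disjoint_left.1 (I.cache_miss j) h1 h2

theorem zmod_two_eq_one {a : ZMod 2} (h : a ≠ 0) : a = 1 := by
  revert a; decide

/-- An XOR coloring scheme is a partition of the users into cliques. -/
theorem isXORColoringScheme_iff (I : ICDH k n) {t : ℕ} (G : Matrix (Fin t) (Fin n) (ZMod 2)) :
    I.IsXORColoringScheme G ↔ (∀ u, ∃! i, G i u ≠ 0) ∧
      ∀ u u' i, u ≠ u' → G i u ≠ 0 → G i u' ≠ 0 → I.graph.Adj u u' := by
  classical
  constructor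
  · intro h
    refine ⟨h.unique, ?_⟩
    have key : ∀ u u' i, u ≠ u' → G i u ≠ 0 → G i u' ≠ 0 → u' ∈ I.sideInfo u := by
      intro u u' i hne hu hu'
      by_contra hmem
      obtain ⟨φ, hφ⟩ := h.decode u i hu
      -- The packets `u` and `u'` cancel in the transmission over `𝔽₂`, and neither is in the side
      -- information of `u`. A linear decoder sees only zeros, yet should return `1`.
      have h1 := hφ (Pi.single u 1 + Pi.single u' 1)
      have h2 : (G *ᵥ (Pi.single u 1 + Pi.single u' 1)) i = 0 := by
        rw [Matrix.mulVec_add]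
        simp [zmod_two_eq_one hu, zmod_two_eq_one hu']
        decide
      have h3 : (fun v : I.sideInfo u =>
          (Pi.single u 1 + Pi.single u' 1 : Fin n → ZMod 2) v) = 0 := by
        ext ⟨v, hv⟩
        have hvu : v ≠ u := fun e => I.not_mem_sideInfo_self u (e ▸ hv)
        have hvu' : v ≠ u' := fun e => hmem (e ▸ hv)
        simp [hvu, hvu']
      rw [h2, h3] at h1
      have h4 : φ (0, 0) = 0 := map_zero φ
      rw [h4] at h1
      simp [hne] at h1
    intro u u' i hne hu hu'
    exact ⟨hne, key u u' i hne hu hu', key u' u i hne.symm hu' hu⟩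
  · rintro ⟨huniq, hadj⟩
    refine ⟨huniq, fun u i hu => ?_⟩
    -- The decoder subtracts the known packets from the transmission; every other participant is a
    -- neighbour of `u`, so nothing unknown but `x u` is left.
    let ψ : (I.sideInfo u → ZMod 2) →ₗ[ZMod 2] ZMod 2 :=
      ∑ v : I.sideInfo u, G i v • LinearMap.proj v
    refine ⟨LinearMap.fst _ _ _ - ψ.comp (LinearMap.snd _ _ _), fun x => ?_⟩
    have h1 : ψ (fun v => x v) = ∑ v : I.sideInfo u, G i v * x v := by
      simp [ψ, LinearMap.sum_apply]
    have h2 : ∑ v : I.sideInfo u, G i v * x v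
        = ∑ v ∈ Finset.univ.filter (· ∈ I.sideInfo u), G i v * x v := by
      rw [Finset.sum_subtype (p := (· ∈ I.sideInfo u)) _ (by simp)]
    have h3 : ∑ v ∈ Finset.univ.filter (· ∈ I.sideInfo u), G i v * x v
        = ∑ v ∈ Finset.univ.erase u, G i v * x v := by
      refine Finset.sum_subset (fun v hv => ?_) fun v hv hv' => ?_
      · refine Finset.mem_erase.2 ⟨?_, Finset.mem_univ _⟩
        rintro rfl
        exact I.not_mem_sideInfo_self _ (Finset.mem_filter.1 hv).2
      · by_contra hne
        refine hv' (Finset.mem_filter.2 ⟨Finset.mem_univ _, ?_⟩)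
        exact (hadj u v i (Finset.ne_of_mem_erase hv).symm hu (left_ne_zero_of_mul hne)).2.1
    simp only [LinearMap.sub_apply, LinearMap.fst_apply, LinearMap.comp_apply,
      LinearMap.snd_apply, h1, h2, h3, Matrix.mulVec, dotProduct]
    rw [← Finset.add_sum_erase _ _ (Finset.mem_univ u), zmod_two_eq_one hu]
    ring

/-! ### The lower bound -/

open Classical in
/-- The categories of the users of color `i`. -/
noncomputable def colorCategories (I : ICDH k n) {t : ℕ} (f : Fin n → Fin t) (i : Fin t) :
    Finset (Category k) :=
  Finset.univ.filter fun v => ∃ u, f u = i ∧ I.InCategory u v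

theorem mem_colorCategories (I : ICDH k n) {t : ℕ} {f : Fin n → Fin t} {i : Fin t}
    {v : Category k} : v ∈ I.colorCategories f i ↔ ∃ u, f u = i ∧ I.InCategory u v := by
  simp [colorCategories]

/-- Different categories of one color come from different users, which are adjacent, and adjacency
passes to the categories. -/
theorem isClique_colorCategories (I : ICDH k n) {t : ℕ} {f : Fin n → Fin t}
    (hf : ∀ u u', u ≠ u' → f u = f u' → I.graph.Adj u u') (i : Fin t) :
    (categoryGraph k).IsClique (I.colorCategories f i : Set (Category k)) := by
  intro v hv w hw hne
  obtain ⟨u, hu, huv⟩ := I.mem_colorCategories.1 hv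
  obtain ⟨u', hu', huw⟩ := I.mem_colorCategories.1 hw
  have hne' : u ≠ u' := by
    rintro rfl
    exact hne (huv.unique huw)
  obtain ⟨v', w', h1, h2, h3⟩ := I.adj_iff_inCategory.1 (hf u u' hne' (hu.trans hu'.symm))
  rwa [huv.unique h1, huw.unique h2]

open Classical in
/-- The number of colors whose categories are those of the clique `S`. -/
noncomputable def colorCount (I : ICDH k n) {t : ℕ} (f : Fin n → Fin t) (S : Clique k) : ℤ :=
  ((Finset.univ.filter fun i => I.colorCategories f i = S.1).card : ℤ)

/-- Double counting of the colors by their sets of categories. Colors without any category belong to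
no clique, whence the condition on `F ∅`. Indicators `F` give both the constraints and the objective
of (IP). -/
theorem sum_mul_colorCount (I : ICDH k n) {t : ℕ} {f : Fin n → Fin t}
    (hf : ∀ u u', u ≠ u' → f u = f u' → I.graph.Adj u u') (F : Finset (Category k) → ℤ)
    (hF : F ∅ = 0) :
    ∑ S : Clique k, F S.1 * I.colorCount f S = ∑ i, F (I.colorCategories f i) := by
  classical
  have h1 : ∀ S : Clique k, F S.1 * I.colorCount f S
      = ∑ i, if I.colorCategories f i = S.1 then F S.1 else 0 := by
    intro S
    rw [colorCount, ← Finset.sum_filter, Finset.sum_const, nsmul_eq_mul, mul_comm]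
  rw [Finset.sum_congr rfl fun S _ => h1 S, Finset.sum_comm]
  refine Finset.sum_congr rfl fun i _ => ?_
  rcases (I.colorCategories f i).eq_empty_or_nonempty with h0 | h0
  · rw [h0, hF]
    refine Finset.sum_eq_zero fun S _ => if_neg fun h => ?_
    exact S.2.1.ne_empty h.symm
  · rw [Finset.sum_eq_single (⟨_, h0, I.isClique_colorCategories hf i⟩ : Clique k)]
    · simp
    · intro S _ hS
      exact if_neg fun h => hS (Subtype.ext h.symm)
    · simp

/-- Users of one category are pairwise non-adjacent, so they get different colors and are in
bijection with the colors that contain the category. -/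
theorem isFeasible_colorCount (I : ICDH k n) {t : ℕ} {f : Fin n → Fin t}
    (hf : ∀ u u', u ≠ u' → f u = f u' → I.graph.Adj u u') : I.IsFeasible (I.colorCount f) := by
  classical
  refine ⟨?_, fun S => by simp [colorCount]⟩
  ext v
  simp only [Matrix.mulVec, dotProduct, constraintMatrix]
  rw [I.sum_mul_colorCount hf (fun S => if v ∈ S then 1 else 0) (by simp), weight_eq,
    ← Finset.sum_filter, Finset.sum_const, nsmul_eq_mul, mul_one]
  congr 1
  symm
  refine Finset.card_bij (fun u _ => f u) ?_ ?_ ?_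
  · intro u hu
    simp only [Finset.mem_filter, Finset.mem_univ, true_and] at hu ⊢
    exact I.mem_colorCategories.2 ⟨u, rfl, I.userCategory_eq_some.1 hu⟩
  · intro u hu u' hu' h
    by_contra hne
    simp only [Finset.mem_filter, Finset.mem_univ, true_and, userCategory_eq_some] at hu hu'
    obtain ⟨v', w', h1, h2, h3⟩ := I.adj_iff_inCategory.1 (hf u u' hne h)
    rw [← hu.unique h1, ← hu'.unique h2] at h3
    exact h3.ne rfl
  · intro i hi
    simp only [Finset.mem_filter, Finset.mem_univ, true_and] at hi
    obtain ⟨u, hu, huv⟩ := I.mem_colorCategories.1 hi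
    exact ⟨u, by simpa [userCategory_eq_some] using huv, hu⟩

/-- An isolated user shares its color with nobody, so isolated users inject into the colors without
categories; the clique counts exhaust the other colors. -/
theorem card_add_sum_colorCount_le (I : ICDH k n) {t : ℕ} {f : Fin n → Fin t}
    (hf : ∀ u u', u ≠ u' → f u = f u' → I.graph.Adj u u') :
    (I.isolatedUsers.card : ℤ) + ∑ S, I.colorCount f S ≤ t := by
  classical
  have h1 : ∑ S, I.colorCount f S
      = ((Finset.univ.filter fun i => (I.colorCategories f i).Nonempty).card : ℤ) := by
    have := I.sum_mul_colorCount hf (fun S => if S.Nonempty then 1 else 0) (by simp)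
    rw [← Finset.sum_filter, Finset.sum_const, nsmul_eq_mul, mul_one] at this
    rw [← this]
    exact Finset.sum_congr rfl fun S _ => by simp [S.2.1]
  have h2 : I.isolatedUsers.card
      ≤ (Finset.univ.filter fun i => ¬ (I.colorCategories f i).Nonempty).card := by
    rw [isolatedUsers_eq]
    refine Finset.card_le_card_of_injOn f ?_ ?_
    · intro u hu
      simp only [Finset.coe_filter, Finset.mem_univ, true_and, Set.mem_ofPred_eq] at hu ⊢
      rintro ⟨v, hv⟩
      obtain ⟨u', hu', huv⟩ := I.mem_colorCategories.1 hv
      by_cases hne : u = u'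
      · rw [hne, I.userCategory_eq_some.2 huv] at hu
        cases hu
      · exact I.userCategory_eq_none.1 hu u' (hf u u' hne hu'.symm)
    · intro u hu u' _ h
      by_contra hne
      simp only [Finset.coe_filter, Finset.mem_univ, true_and, Set.mem_ofPred_eq] at hu
      exact I.userCategory_eq_none.1 hu u' (hf u u' hne h)
  have h3 := Finset.card_filter_add_card_filter_not (s := (Finset.univ : Finset (Fin t)))
    (fun i => (I.colorCategories f i).Nonempty)
  rw [Finset.card_univ, Fintype.card_fin] at h3
  rw [h1]
  omega

theorem IsOptimalSolution.card_add_sum_le {I : ICDH k n} {c : Clique k → ℤ}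
    (hc : I.IsOptimalSolution c) {t : ℕ} {G : Matrix (Fin t) (Fin n) (ZMod 2)}
    (hG : I.IsXORColoringScheme G) : (I.isolatedUsers.card : ℤ) + ∑ S, c S ≤ t := by
  obtain ⟨h1, h2⟩ := (I.isXORColoringScheme_iff G).1 hG
  choose f hf _ using h1
  have hadj : ∀ u u', u ≠ u' → f u = f u' → I.graph.Adj u u' := by
    intro u u' hne h
    have := hf u
    rw [h] at this
    exact h2 u u' (f u') hne this (hf u')
  have h3 := hc.2 _ (I.isFeasible_colorCount hadj)
  have h4 := I.card_add_sum_colorCount_le hadj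
  linarith

/-! ### The scheme of a solution of the integer program -/

/-- The assignment `col` of transmissions to the users comes from the solution `c`: clique `S` owns
the transmissions `off S, …, off S + c S - 1`. -/
structure IsSchedule (I : ICDH k n) (off c : Clique k → ℕ) (t : ℕ) (col : ℕ → ℕ) : Prop where
  feasible : I.IsFeasible fun S => (c S : ℤ)
  disjoint : ∀ S S' x, off S ≤ x → x < off S + c S → off S' ≤ x → x < off S' + c S' → S = S'
  le_sum : ∀ S, off S + c S ≤ ∑ S, c S
  length : t = ∑ S, c S + I.isolatedUsers.card
  isolated : ∀ u : Fin n, I.userCategory u = none → ∑ S, c S ≤ col u ∧ col u < t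
  isolated_inj : ∀ u u' : Fin n, I.userCategory u = none → I.userCategory u' = none →
    col u = col u' → u = u'
  mem : ∀ (u : Fin n) v, I.userCategory u = some v →
    ∃ S : Clique k, v ∈ S.1 ∧ off S ≤ col u ∧ col u < off S + c S
  inj : ∀ (u u' : Fin n) v, I.userCategory u = some v → I.userCategory u' = some v →
    col u = col u' → u = u'

namespace IsSchedule

variable {I : ICDH k n} {off c : Clique k → ℕ} {t : ℕ} {col : ℕ → ℕ}

/-- The users of category `v` inject into the intervals of the cliques containing `v`. By `Ac = w`
both sets have the same size, so the injection is onto. -/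
theorem exists_user (h : I.IsSchedule off c t col) {S : Clique k} {v : Category k} (hv : v ∈ S.1)
    {x : ℕ} (h1 : off S ≤ x) (h2 : x < off S + c S) :
    ∃ u : Fin n, I.userCategory u = some v ∧ col u = x := by
  classical
  let A := Finset.univ.filter fun u => I.userCategory u = some v
  let B := (Finset.univ.filter fun S : Clique k => v ∈ S.1).biUnion
    fun S => Finset.Ico (off S) (off S + c S)
  have hB : B.card = ∑ S : Clique k, if v ∈ S.1 then c S else 0 := by
    rw [Finset.card_biUnion, ← Finset.sum_filter]
    · simp
    · intro S _ S' _ hne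
      rw [Function.onFun, Finset.disjoint_left]
      intro y hy hy'
      rw [Finset.mem_Ico] at hy hy'
      exact hne (h.disjoint S S' y hy.1 hy.2 hy'.1 hy'.2)
  have hA : A.card = B.card := by
    have := congrFun h.feasible.1 v
    rw [weight_eq] at this
    simp only [Matrix.mulVec, dotProduct, constraintMatrix, ite_mul, one_mul, zero_mul] at this
    rw [hB]
    have h' : ((∑ S : Clique k, if v ∈ S.1 then c S else 0 : ℕ) : ℤ) = A.card := by
      rw [← this]
      push_cast
      rfl
    exact_mod_cast h'.symm
  have hsurj := Finset.surjOn_of_injOn_of_card_le (s := A) (t := B) (fun u => col u) (by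
      intro u hu
      obtain ⟨S, hS, h1, h2⟩ := h.mem u v (by simpa [A] using hu)
      simp only [B, Finset.coe_biUnion, Set.mem_iUnion, Finset.coe_filter, Finset.mem_univ,
        true_and, Set.mem_ofPred_eq, Finset.coe_Ico, Set.mem_Ico]
      exact ⟨S, hS, h1, h2⟩) (by
      intro u hu u' hu' he
      exact h.inj u u' v (by simpa [A] using hu) (by simpa [A] using hu') he) hA.ge
  obtain ⟨u, hu, hux⟩ := hsurj (show x ∈ (B : Set ℕ) by
    simp only [B, Finset.coe_biUnion, Set.mem_iUnion, Finset.coe_filter, Finset.mem_univ,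
        true_and, Set.mem_ofPred_eq, Finset.coe_Ico, Set.mem_Ico]
    exact ⟨S, hv, h1, h2⟩)
  exact ⟨u, by simpa [A] using hu, hux⟩

theorem categories_eq (h : I.IsSchedule off c t col) {S : Clique k} {x : ℕ} (h1 : off S ≤ x)
    (h2 : x < off S + c S) :
    {v : Category k | ∃ u : Fin n, col u = x ∧ I.InCategory u v} = (S.1 : Set (Category k)) := by
  ext v
  constructor
  · rintro ⟨u, rfl, hu⟩
    obtain ⟨S', hS', h1', h2'⟩ := h.mem u v (I.userCategory_eq_some.2 hu)
    rwa [h.disjoint S S' _ h1 h2 h1' h2']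
  · intro hv
    obtain ⟨u, hu, hx⟩ := h.exists_user hv h1 h2
    exact ⟨u, hx, I.userCategory_eq_some.1 hu⟩

theorem col_lt (h : I.IsSchedule off c t col) (u : Fin n) : col u < t := by
  cases hu : I.userCategory u with
  | none => exact (h.isolated u hu).2
  | some v =>
    obtain ⟨S, -, -, h2⟩ := h.mem u v hu
    have := h.le_sum S
    have := h.length
    omega

theorem ncard_eq (h : I.IsSchedule off c t col) (S : Clique k) :
    {i : Fin t | {v : Category k | ∃ u : Fin n, col u = i ∧ I.InCategory u v}
      = (S.1 : Set (Category k))}.ncard = c S := by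
  have h1 : (Fin.val '' {i : Fin t | {v : Category k | ∃ u : Fin n, col u = i ∧ I.InCategory u v}
      = (S.1 : Set (Category k))}) = (Finset.Ico (off S) (off S + c S) : Set ℕ) := by
    ext x
    simp only [Set.mem_image, Set.mem_ofPred_eq, Finset.coe_Ico, Set.mem_Ico]
    constructor
    · rintro ⟨i, hi, rfl⟩
      -- As `S` is non-empty, the transmission carries a user with a category. This places it in the
      -- interval of some `S'`, whose category set is exactly `S'`, forcing `S = S'`.
      obtain ⟨v, hv⟩ := S.2.1
      have hv' : v ∈ {v : Category k | ∃ u : Fin n, col u = i ∧ I.InCategory u v} := by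
        rw [hi]; exact hv
      obtain ⟨u, hu, huv⟩ := hv'
      obtain ⟨S', hS', h1', h2'⟩ := h.mem u v (I.userCategory_eq_some.2 huv)
      rw [hu] at h1' h2'
      have h3 := h.categories_eq h1' h2'
      rw [hi] at h3
      have h4 : S = S' := Subtype.ext (Finset.coe_injective h3)
      rw [h4]
      exact ⟨h1', h2'⟩
    · rintro ⟨h1', h2'⟩
      have := h.le_sum S
      have := h.length
      exact ⟨⟨x, by omega⟩, h.categories_eq h1' h2', rfl⟩
  rw [← Set.ncard_image_of_injective _ Fin.val_injective, h1, Set.ncard_coe_finset]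
  simp

/-- Isolated users sit beyond all the intervals, each alone. Two other users of one transmission lie
in the interval of a single clique and, by injectivity within a category, in different categories of
it. -/
theorem isXORColoringScheme (h : I.IsSchedule off c t col) :
    I.IsXORColoringScheme (encodingMatrix n t col) := by
  have key : ∀ (i : Fin t) (u : Fin n), encodingMatrix n t col i u ≠ 0 ↔ col u = i := by
    intro i u
    simp [encodingMatrix]
  rw [isXORColoringScheme_iff]
  refine ⟨fun u => ⟨⟨col u, h.col_lt u⟩, (key _ _).2 rfl, fun i hi => ?_⟩, ?_⟩
  · exact Fin.ext ((key _ _).1 hi).symm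
  · intro u u' i hne hu hu'
    rw [key] at hu hu'
    have hcc : col u = col u' := hu.trans hu'.symm
    have hlt : ∀ (w : Fin n) v, I.userCategory w = some v → col w < ∑ S, c S := by
      intro w v hw
      obtain ⟨S, -, -, h2⟩ := h.mem w v hw
      exact h2.trans_le (h.le_sum S)
    cases hv : I.userCategory u with
    | none =>
      cases hw : I.userCategory u' with
      | none => exact absurd (h.isolated_inj u u' hv hw hcc) hne
      | some w =>
        have := (h.isolated u hv).1
        have := hlt u' w hw
        omega
    | some v =>
      cases hw : I.userCategory u' with
      | none =>
        have := (h.isolated u' hw).1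
        have := hlt u v hv
        omega
      | some w =>
        obtain ⟨S, hS, h1, h2⟩ := h.mem u v hv
        obtain ⟨S', hS', h1', h2'⟩ := h.mem u' w hw
        rw [← hcc] at h1' h2'
        obtain rfl := h.disjoint S S' _ h1 h2 h1' h2'
        refine I.adj_iff_inCategory.2 ⟨v, w, I.userCategory_eq_some.1 hv,
          I.userCategory_eq_some.1 hw, S.2.2 hS hS' ?_⟩
        rintro rfl
        exact hne (h.inj u u' v hv hw hcc)

theorem length_eq (h : I.IsSchedule off c t col) :
    (t : ℤ) = I.isolatedUsers.card + ∑ S, (c S : ℤ) := by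
  rw [h.length]
  push_cast
  ring

theorem isOptimalXORColoringScheme (h : I.IsSchedule off c t col)
    (hc : I.IsOptimalSolution fun S => (c S : ℤ)) :
    I.IsOptimalXORColoringScheme (encodingMatrix n t col) := by
  refine ⟨h.isXORColoringScheme, fun t' G' hG' => ?_⟩
  have := hc.card_add_sum_le hG'
  rw [← h.length_eq] at this
  exact_mod_cast this

end IsSchedule

end ICDH

namespace RAM

/-! ### Loop-free code over named variables -/

/-- A state with named variables. -/
structure Store (V : Type) where
  reg : V → ℕ
  mem : ℕ → ℕ

/-- Loop-free code over named variables. -/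
inductive Code (V : Type) where
  | skip : Code V
  | const (r : V) (a : ℕ) : Code V
  | add (r s t : V) : Code V
  | sub (r s t : V) : Code V
  | load (r s : V) : Code V
  | store (r s : V) : Code V
  | seq (P Q : Code V) : Code V
  | ite (r : V) (P Q : Code V) : Code V

variable {V : Type}

def Store.setReg [DecidableEq V] (s : Store V) (r : V) (a : ℕ) : Store V := ⟨Function.update s.reg r a, s.mem⟩

def Store.setMem (s : Store V) (p a : ℕ) : Store V := ⟨s.reg, Function.update s.mem p a⟩

@[simp] theorem Store.setReg_mem [DecidableEq V] (s : Store V) (r : V) (a : ℕ) :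
    (s.setReg r a).mem = s.mem := rfl

@[simp] theorem Store.setMem_reg (s : Store V) (p a : ℕ) : (s.setMem p a).reg = s.reg := rfl

theorem Store.setReg_reg [DecidableEq V] (s : Store V) (r : V) (a : ℕ) (x : V) :
    (s.setReg r a).reg x = if x = r then a else s.reg x := by
  simp [Store.setReg, Function.update_apply]

theorem Store.setMem_mem (s : Store V) (p a q : ℕ) :
    (s.setMem p a).mem q = if q = p then a else s.mem q := by
  simp [Store.setMem, Function.update_apply]

/-- The effect of loop-free code. -/
def Code.run [DecidableEq V] : Code V → Store V → Store V
  | .skip, σ => σ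
  | .const r a, σ => σ.setReg r a
  | .add r s t, σ => σ.setReg r (σ.reg s + σ.reg t)
  | .sub r s t, σ => σ.setReg r (σ.reg s - σ.reg t)
  | .load r s, σ => σ.setReg r (σ.mem (σ.reg s))
  | .store r s, σ => σ.setMem (σ.reg r) (σ.reg s)
  | .seq P Q, σ => Q.run (P.run σ)
  | .ite r P Q, σ => if σ.reg r ≠ 0 then P.run σ else Q.run σ

/-- Compilation, given the registers that hold the variables. -/
def Code.compile (ρ : V → ℕ) : Code V → Program
  | .skip => .skip
  | .const r a => .const (ρ r) a
  | .add r s t => .add (ρ r) (ρ s) (ρ t)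
  | .sub r s t => .sub (ρ r) (ρ s) (ρ t)
  | .load r s => .load (ρ r) (ρ s)
  | .store r s => .store (ρ r) (ρ s)
  | .seq P Q => .seq (P.compile ρ) (Q.compile ρ)
  | .ite r P Q => .ifNonzero (ρ r) (P.compile ρ) (Q.compile ρ)

/-- The machine state `σ` holds the variables of `s` in the registers `ρ`. -/
def Represents (ρ : V → ℕ) (σ : State) (s : Store V) : Prop :=
  (∀ v, σ.reg (ρ v) = s.reg v) ∧ σ.mem = s.mem

/-- All values of the state are at most `B`. -/
def Store.Bounded (s : Store V) (B : ℕ) : Prop := (∀ v, s.reg v ≤ B) ∧ ∀ p, s.mem p ≤ B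

theorem Store.Bounded.mono {s : Store V} {B B' : ℕ} (h : s.Bounded B) (hB : B ≤ B') :
    s.Bounded B' :=
  ⟨fun v => (h.1 v).trans hB, fun p => (h.2 p).trans hB⟩

theorem Store.Bounded.setReg [DecidableEq V] {s : Store V} {B a : ℕ} (h : s.Bounded B) (r : V) (ha : a ≤ B) :
    (s.setReg r a).Bounded B := by
  refine ⟨fun v => ?_, h.2⟩
  rw [Store.setReg_reg]
  split_ifs
  exacts [ha, h.1 v]

theorem Store.Bounded.setMem {s : Store V} {B a : ℕ} (h : s.Bounded B) (p : ℕ) (ha : a ≤ B) :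
    (s.setMem p a).Bounded B := by
  refine ⟨h.1, fun q => ?_⟩
  rw [Store.setMem_mem]
  split_ifs
  exacts [ha, h.2 q]

theorem Represents.setReg [DecidableEq V] {ρ : V → ℕ} (hρ : Function.Injective ρ) {σ : State} {s : Store V}
    (h : Represents ρ σ s) (r : V) (a : ℕ) :
    Represents ρ (σ.setReg (ρ r) a) (s.setReg r a) := by
  refine ⟨fun v => ?_, h.2⟩
  simp [State.setReg, Store.setReg, Function.update_apply, hρ.eq_iff, h.1]

theorem Represents.setMem {ρ : V → ℕ} {σ : State} {s : Store V}
    (h : Represents ρ σ s) (p a : ℕ) :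
    Represents ρ (σ.setMem p a) (s.setMem p a) := by
  refine ⟨h.1, ?_⟩
  simp [State.setMem, Store.setMem, h.2]

theorem bitCost_mono {a b : ℕ} (h : a ≤ b) : bitCost a ≤ bitCost b :=
  Nat.add_le_add_right (Nat.size_le_size h) 1

theorem one_le_bitCost (a : ℕ) : 1 ≤ bitCost a := Nat.le_add_left _ _

theorem bitCost_mul_le (a b : ℕ) : bitCost (a * b) ≤ bitCost a + bitCost b := by
  have : Nat.size (a * b) ≤ Nat.size a + Nat.size b := by
    rw [Nat.size_le, pow_add]
    exact Nat.mul_lt_mul'' (Nat.lt_size_self a) (Nat.lt_size_self b)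
  unfold bitCost
  omega

theorem bitCost_succ_le (a : ℕ) : bitCost (a + 1) ≤ bitCost a + 1 := by
  have : Nat.size (a + 1) ≤ Nat.size a + 1 := by
    rw [Nat.size_le, pow_succ]
    have h1 := Nat.lt_size_self a
    omega
  unfold bitCost
  omega

/-- The machine runs `P` from `s` to `s'` at cost at most `c`. -/
def Runs (ρ : V → ℕ) (P : Program) (s s' : Store V) (c : ℕ) : Prop :=
  ∀ σ, Represents ρ σ s → ∃ τ d, Exec P σ τ d ∧ Represents ρ τ s' ∧ d ≤ c

theorem Runs.mono {ρ : V → ℕ} {P : Program} {s s' : Store V} {c c' : ℕ} (h : Runs ρ P s s' c)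
    (hc : c ≤ c') : Runs ρ P s s' c' := fun σ hσ =>
  let ⟨τ, d, h1, h2, h3⟩ := h σ hσ
  ⟨τ, d, h1, h2, h3.trans hc⟩

theorem Runs.seq {ρ : V → ℕ} {P Q : Program} {s s' s'' : Store V} {c d : ℕ}
    (h : Runs ρ P s s' c) (h' : Runs ρ Q s' s'' d) : Runs ρ (.seq P Q) s s'' (c + d) := by
  intro σ hσ
  obtain ⟨τ, c', h1, h2, h3⟩ := h σ hσ
  obtain ⟨υ, d', h4, h5, h6⟩ := h' τ h2
  exact ⟨υ, c' + d', .seq h1 h4, h5, by omega⟩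

/-- Loop-free code takes a constant number of steps, and multiplies the values by a constant at
most. -/
theorem Code.exists_runs [DecidableEq V] {ρ : V → ℕ} (hρ : Function.Injective ρ) (P : Code V) :
    ∃ a, ∀ B s, Store.Bounded s B →
      Runs ρ (P.compile ρ) s (P.run s) (a * bitCost B) ∧ (P.run s).Bounded (a * (B + 1)) := by
  have hle : ∀ {a B : ℕ}, 1 ≤ a → B ≤ a * (B + 1) := fun {a B} h => by nlinarith
  induction P with
  | skip =>
    refine ⟨1, fun B s hs => ⟨fun σ hσ => ⟨σ, _, .skip σ, hσ, ?_⟩, hs.mono (hle le_rfl)⟩⟩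
    simpa using one_le_bitCost B
  | const r a =>
    refine ⟨bitCost a + a, fun B s hs => ⟨fun σ hσ => ⟨_, _, .const σ _ a, hσ.setReg hρ r a, ?_⟩,
      (hs.mono (hle ?_)).setReg r ?_⟩⟩
    · nlinarith [one_le_bitCost B, one_le_bitCost a]
    · have := one_le_bitCost a; omega
    · nlinarith
  | add r p q =>
    refine ⟨2, fun B s hs => ⟨fun σ hσ => ⟨_, _, .add σ _ _ _, ?_, ?_⟩,
      (hs.mono (hle (by norm_num))).setReg r ?_⟩⟩
    · rw [hσ.1, hσ.1]; exact hσ.setReg hρ r _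
    · rw [hσ.1, hσ.1]
      have h1 := bitCost_mono (hs.1 p)
      have h2 := bitCost_mono (hs.1 q)
      omega
    · have h1 := hs.1 p
      have h2 := hs.1 q
      omega
  | sub r p q =>
    refine ⟨2, fun B s hs => ⟨fun σ hσ => ⟨_, _, .sub σ _ _ _, ?_, ?_⟩,
      (hs.mono (hle (by norm_num))).setReg r ?_⟩⟩
    · rw [hσ.1, hσ.1]; exact hσ.setReg hρ r _
    · rw [hσ.1, hσ.1]
      have h1 := bitCost_mono (hs.1 p)
      have h2 := bitCost_mono (hs.1 q)
      omega
    · have h1 := hs.1 p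
      omega
  | load r p =>
    refine ⟨2, fun B s hs => ⟨fun σ hσ => ⟨_, _, .load σ _ _, ?_, ?_⟩,
      (hs.mono (hle (by norm_num))).setReg r ?_⟩⟩
    · rw [hσ.1, hσ.2]; exact hσ.setReg hρ r _
    · rw [hσ.1, hσ.2]
      have h1 := bitCost_mono (hs.1 p)
      have h2 := bitCost_mono (hs.2 (s.reg p))
      omega
    · have h1 := hs.2 (s.reg p)
      omega
  | store r p =>
    refine ⟨2, fun B s hs => ⟨fun σ hσ => ⟨_, _, .store σ _ _, ?_, ?_⟩,
      (hs.mono (hle (by norm_num))).setMem _ ?_⟩⟩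
    · rw [hσ.1, hσ.1]; exact hσ.setMem _ _
    · rw [hσ.1, hσ.1]
      have h1 := bitCost_mono (hs.1 r)
      have h2 := bitCost_mono (hs.1 p)
      omega
    · have h1 := hs.1 p
      omega
  | seq P Q hP hQ =>
    obtain ⟨a, ha⟩ := hP
    obtain ⟨b, hb⟩ := hQ
    -- `Q` starts with values up to `a * (B + 1)`, of bit cost at most `(bitCost a + 2) * bitCost
    -- B`. The first two terms pay for the cost, the last one for the final size of the values.
    refine ⟨a + b * (bitCost a + 2) + b * (a + 1), fun B s hs => ?_⟩
    obtain ⟨h1, h2⟩ := ha B s hs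
    obtain ⟨h3, h4⟩ := hb _ _ h2
    refine ⟨(h1.seq h3).mono ?_, h4.mono ?_⟩
    · have h5 : bitCost (a * (B + 1)) ≤ (bitCost a + 2) * bitCost B := by
        have := bitCost_mul_le a (B + 1)
        have := bitCost_succ_le B
        nlinarith [one_le_bitCost B, one_le_bitCost a]
      have h6 := Nat.mul_le_mul_left b h5
      nlinarith [Nat.zero_le (b * (a + 1) * bitCost B)]
    · have h7 : a * (B + 1) + 1 ≤ (a + 1) * (B + 1) := by nlinarith
      have h8 := Nat.mul_le_mul_left b h7
      nlinarith [Nat.zero_le ((a + b * (bitCost a + 2)) * (B + 1))]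
  | ite r P Q hP hQ =>
    obtain ⟨a, ha⟩ := hP
    obtain ⟨b, hb⟩ := hQ
    refine ⟨1 + a + b, fun B s hs => ?_⟩
    have hc := bitCost_mono (hs.1 r)
    by_cases hr : s.reg r = 0
    · obtain ⟨h1, h2⟩ := hb B s hs
      simp only [Code.run, hr, ne_eq, not_true_eq_false, if_false, Code.compile]
      refine ⟨fun σ hσ => ?_, h2.mono ?_⟩
      · obtain ⟨τ, d, h3, h4, h5⟩ := h1 σ hσ
        refine ⟨τ, _, .ifFalse (by rw [hσ.1, hr]) h3, h4, ?_⟩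
        rw [hσ.1]
        nlinarith [Nat.zero_le (a * bitCost B)]
      · nlinarith [Nat.zero_le (a * (B + 1))]
    · obtain ⟨h1, h2⟩ := ha B s hs
      simp only [Code.run, hr, ne_eq, not_false_eq_true, if_true, Code.compile]
      refine ⟨fun σ hσ => ?_, h2.mono ?_⟩
      · obtain ⟨τ, d, h3, h4, h5⟩ := h1 σ hσ
        refine ⟨τ, _, .ifTrue (by rwa [hσ.1]) h3, h4, ?_⟩
        rw [hσ.1]
        nlinarith [Nat.zero_le (b * bitCost B)]
      · nlinarith [Nat.zero_le (b * (B + 1))]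

/-! ### Quasilinear programs -/

/-- On the instance `x` of size `N x`, the program `P` leads from every state with `pre x` to a
state with `post x`, in quasilinear time. -/
def Computes {ι : Type*} (N : ι → ℕ) (ρ : V → ℕ) (P : Program) (pre post : ι → Store V → Prop) :
    Prop :=
  ∃ a, ∀ x s, pre x s → ∃ s', post x s' ∧ Runs ρ P s s' (a * ((N x + 1) * bitCost (N x)))

section Computes

variable {ι : Type*} {N : ι → ℕ} {ρ : V → ℕ}

theorem Computes.seq {P Q : Program} {p q r : ι → Store V → Prop} (hP : Computes N ρ P p q)
    (hQ : Computes N ρ Q q r) : Computes N ρ (.seq P Q) p r := by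
  obtain ⟨a, ha⟩ := hP
  obtain ⟨b, hb⟩ := hQ
  refine ⟨a + b, fun x s hs => ?_⟩
  obtain ⟨s', h1, h2⟩ := ha x s hs
  obtain ⟨s'', h3, h4⟩ := hb x s' h1
  exact ⟨s'', h3, (h2.seq h4).mono (add_mul a b _).ge⟩

theorem bitCost_linear_le (K n : ℕ) : bitCost (K * (n + 1)) ≤ (bitCost K + 2) * bitCost n := by
  have := bitCost_mul_le K (n + 1)
  have := bitCost_succ_le n
  nlinarith [one_le_bitCost n, one_le_bitCost K]

theorem Computes.code [DecidableEq V] (hρ : Function.Injective ρ) (P : Code V) {p q : ι → Store V → Prop} (K : ℕ)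
    (hB : ∀ x s, p x s → s.Bounded (K * (N x + 1))) (h : ∀ x s, p x s → q x (P.run s)) :
    Computes N ρ (P.compile ρ) p q := by
  obtain ⟨a, ha⟩ := P.exists_runs hρ
  refine ⟨a * (bitCost K + 2), fun x s hs => ⟨_, h x s hs, ((ha _ s (hB x s hs)).1).mono ?_⟩⟩
  rw [mul_assoc]
  refine Nat.mul_le_mul_left a ((bitCost_linear_le K (N x)).trans ?_)
  exact Nat.mul_le_mul_left _ (Nat.le_mul_of_pos_left _ (Nat.succ_pos _))

/-- A loop whose body is loop-free, with invariant `p` and a variant `μ` of linear size. -/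
theorem Computes.while [DecidableEq V] (hρ : Function.Injective ρ) (r : V) (P : Code V)
    {p : ι → Store V → Prop} (K : ℕ) (μ : ι → Store V → ℕ)
    (hB : ∀ x s, p x s → s.Bounded (K * (N x + 1))) (hμ : ∀ x s, p x s → μ x s ≤ N x + 1)
    (h : ∀ x s, p x s → s.reg r ≠ 0 → p x (P.run s) ∧ μ x (P.run s) < μ x s) :
    Computes N ρ (.whileNonzero (ρ r) (P.compile ρ)) p fun x s => p x s ∧ s.reg r = 0 := by
  obtain ⟨a, ha⟩ := P.exists_runs hρ
  -- Each pass costs `a` for the body and `1` for the test, in units of the bit cost of the value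
  -- bound. With the last test there are at most `N x + 2` tests, which `3 * (N x + 1)` covers.
  refine ⟨3 * ((a + 1) * (bitCost K + 2)), fun x s hs => ?_⟩
  -- The growth factors of `Code.exists_runs` would compound from pass to pass; the bound on the
  -- values is instead renewed from the invariant before each pass.
  have key : ∀ m s, p x s → μ x s ≤ m → ∃ s', (p x s' ∧ s'.reg r = 0) ∧
      Runs ρ (.whileNonzero (ρ r) (P.compile ρ)) s s'
        ((m + 1) * ((a + 1) * bitCost (K * (N x + 1)))) := by
    intro m
    induction m with
    | zero =>
      intro s hs hm
      have hr : s.reg r = 0 := by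
        by_contra hr
        have := (h x s hs hr).2
        omega
      refine ⟨s, ⟨hs, hr⟩, fun σ hσ => ⟨σ, _, .whileDone (by rw [hσ.1, hr]), hσ, ?_⟩⟩
      rw [hσ.1]
      have := bitCost_mono ((hB x s hs).1 r)
      nlinarith [Nat.zero_le (a * bitCost (K * (N x + 1)))]
    | succ m ih =>
      intro s hs hm
      have hc := bitCost_mono ((hB x s hs).1 r)
      by_cases hr : s.reg r = 0
      · refine ⟨s, ⟨hs, hr⟩, fun σ hσ => ⟨σ, _, .whileDone (by rw [hσ.1, hr]), hσ, ?_⟩⟩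
        rw [hσ.1]
        nlinarith [Nat.zero_le (a * bitCost (K * (N x + 1))),
          Nat.zero_le ((m + 1) * ((a + 1) * bitCost (K * (N x + 1))))]
      · obtain ⟨h1, h2⟩ := h x s hs hr
        obtain ⟨s', h3, h4⟩ := ih _ h1 (by omega)
        refine ⟨s', h3, fun σ hσ => ?_⟩
        obtain ⟨τ, d, h5, h6, h7⟩ := (ha _ s (hB x s hs)).1 σ hσ
        obtain ⟨υ, e, h8, h9, h10⟩ := h4 τ h6
        refine ⟨υ, _, .whileStep (by rwa [hσ.1]) h5 h8, h9, ?_⟩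
        rw [hσ.1]
        nlinarith
  obtain ⟨s', h1, h2⟩ := key _ s hs (hμ x s hs)
  refine ⟨s', h1, h2.mono ?_⟩
  have h3 := Nat.mul_le_mul_left (a + 1) (bitCost_linear_le K (N x))
  calc (N x + 1 + 1) * ((a + 1) * bitCost (K * (N x + 1)))
      ≤ (3 * (N x + 1)) * ((a + 1) * ((bitCost K + 2) * bitCost (N x))) :=
        Nat.mul_le_mul (by omega) h3
    _ = _ := by ring

theorem Computes.weaken {P : Program} {p q p' q' : ι → Store V → Prop} (h : Computes N ρ P p q)
    (hp : ∀ x s, p' x s → p x s) (hq : ∀ x s, q x s → q' x s) : Computes N ρ P p' q' := by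
  obtain ⟨a, ha⟩ := h
  refine ⟨a, fun x s hs => ?_⟩
  obtain ⟨s', h1, h2⟩ := ha x s (hp x s hs)
  exact ⟨s', hq x s' h1, h2⟩

end Computes

theorem isBigO_mul_bitCost (a : ℕ) :
    (fun n : ℕ => ((a * ((n + 1) * bitCost n) : ℕ) : ℝ)) =O[Filter.atTop]
      fun n : ℕ => (n : ℝ) * Real.log n := by
  -- For `n ≥ 2`, `n + 1 ≤ 2n` and the bit cost is at most `2 + log₂ n ≤ 3 log₂ n`.
  refine Asymptotics.IsBigO.of_bound (a * (2 * (2 / Real.log 2 + 1 / Real.log 2 ))) ?_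
  filter_upwards [Filter.eventually_ge_atTop 2] with n hn
  have hn' : (2 : ℝ) ≤ n := by exact_mod_cast hn
  have hlog2 : 0 < Real.log 2 := Real.log_pos (by norm_num)
  have hlog : Real.log 2 ≤ Real.log n := Real.log_le_log (by norm_num) hn'
  have h1 : (Nat.size n : ℝ) ≤ 1 + Real.log n / Real.log 2 := by
    have : 2 ^ (Nat.size n - 1) ≤ n := by
      rw [← Nat.lt_size]
      have : 0 < Nat.size n := Nat.size_pos.2 (by omega)
      omega
    have h2 : ((2 : ℝ) ^ (Nat.size n - 1)) ≤ n := by exact_mod_cast this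
    have h3 := Real.log_le_log (by positivity) h2
    rw [Real.log_pow] at h3
    have h4 : ((Nat.size n - 1 : ℕ) : ℝ) ≤ Real.log n / Real.log 2 := (le_div_iff₀ hlog2).2 h3
    have h5 : Nat.size n ≤ 1 + (Nat.size n - 1) := by omega
    have h6 : (Nat.size n : ℝ) ≤ 1 + ((Nat.size n - 1 : ℕ) : ℝ) := by exact_mod_cast h5
    linarith
  have h2 : (bitCost n : ℝ) ≤ (2 / Real.log 2 + 1 / Real.log 2) * Real.log n := by
    have h3 : (1 : ℝ) ≤ Real.log n / Real.log 2 := (one_le_div hlog2).2 hlog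
    unfold bitCost
    push_cast
    have h4 : (2 / Real.log 2 + 1 / Real.log 2) * Real.log n
        = 3 * (Real.log n / Real.log 2) := by ring
    rw [h4]
    linarith
  have h0 : 0 ≤ Real.log n := by linarith
  rw [Real.norm_of_nonneg (by positivity), Real.norm_of_nonneg (by positivity)]
  push_cast
  calc (a : ℝ) * ((n + 1) * bitCost n)
      ≤ a * ((2 * n) * ((2 / Real.log 2 + 1 / Real.log 2) * Real.log n)) := by
        gcongr
        linarith
    _ = _ := by ring

end RAM

namespace ICDH

variable {k n : ℕ}

/-! ### Serving the users one by one -/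

/-- The number of users among the first `m` whose category is `x`. -/
noncomputable def countBefore (I : ICDH k n) (m : ℕ) (x : Option (Category k)) : ℕ :=
  open Classical in (Finset.univ.filter fun u : Fin n => u.val < m ∧ I.userCategory u = x).card

theorem countBefore_zero (I : ICDH k n) (x : Option (Category k)) : I.countBefore 0 x = 0 := by
  simp [countBefore]

theorem countBefore_succ (I : ICDH k n) {m : ℕ} (hm : m < n) (x : Option (Category k)) :
    I.countBefore (m + 1) x =
      I.countBefore m x + open Classical in if I.userCategory ⟨m, hm⟩ = x then 1 else 0 := by
  classical
  unfold countBefore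
  split_ifs with h
  · have : (Finset.univ.filter fun u : Fin n => u.val < m + 1 ∧ I.userCategory u = x)
        = insert ⟨m, hm⟩ (Finset.univ.filter fun u : Fin n => u.val < m ∧ I.userCategory u = x) := by
      ext u
      simp only [Finset.mem_filter, Finset.mem_univ, true_and, Finset.mem_insert, Fin.ext_iff]
      constructor
      · rintro ⟨h1, h2⟩
        by_cases hu : u.val = m
        · exact .inl hu
        · exact .inr ⟨by omega, h2⟩
      · rintro (hu | ⟨h1, h2⟩)
        · have : u = ⟨m, hm⟩ := Fin.ext hu
          subst this
          exact ⟨by simp, h⟩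
        · exact ⟨by omega, h2⟩
    rw [this, Finset.card_insert_of_notMem (by simp)]
  · rw [add_zero]
    congr 1
    ext u
    simp only [Finset.mem_filter, Finset.mem_univ, true_and]
    constructor
    · rintro ⟨h1, h2⟩
      refine ⟨?_, h2⟩
      by_contra hu
      have : u = ⟨m, hm⟩ := Fin.ext (by simp; omega)
      exact h (this ▸ h2)
    · rintro ⟨h1, h2⟩
      exact ⟨by omega, h2⟩

theorem countBefore_self (I : ICDH k n) (x : Option (Category k)) : I.countBefore n x =
    open Classical in (Finset.univ.filter fun u : Fin n => I.userCategory u = x).card := by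
  simp [countBefore]

theorem countBefore_le (I : ICDH k n) {m : ℕ} (hm : m ≤ n) (x : Option (Category k)) :
    I.countBefore m x ≤ m := by
  induction m with
  | zero => simp [countBefore_zero]
  | succ m ih =>
    rw [I.countBefore_succ hm]
    have := ih (by omega)
    split_ifs <;> omega

theorem sum_countBefore_le (I : ICDH k n) {m : ℕ} (hm : m ≤ n) :
    ∑ v, I.countBefore m (some v) ≤ m := by
  classical
  induction m with
  | zero => simp [countBefore_zero]
  | succ m ih =>
    have h1 := ih (by omega)
    simp only [I.countBefore_succ hm, Finset.sum_add_distrib]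
    refine Nat.add_le_add h1 ?_
    cases I.userCategory ⟨m, hm⟩ with
    | none => simp
    | some v => simp

/-- Disjoint intervals of `c S` transmissions, beginning at `off S`, for the cliques `S`. -/
structure IsLayout (off c : Clique k → ℕ) : Prop where
  disjoint : ∀ S S' x, off S ≤ x → x < off S + c S → off S' ≤ x → x < off S' + c S' → S = S'
  le_sum : ∀ S, off S + c S ≤ ∑ S, c S

/-- The first `m` users are served; `rem v S` transmissions of clique `S` still lack a user of
category `v`, and the first of them is `ptr v S`. -/
structure Progress (I : ICDH k n) (off c : Clique k → ℕ) (m : ℕ)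
    (ptr rem : Category k → Clique k → ℕ) (tc : ℕ) (col : ℕ → ℕ) : Prop where
  off_le : ∀ v S, off S ≤ ptr v S
  ptr_add : ∀ v S, ptr v S + rem v S = off S + c S
  tc_eq : tc = ∑ S, c S + I.countBefore m none
  isolated : ∀ u : Fin n, u.val < m → I.userCategory u = none → ∑ S, c S ≤ col u ∧ col u < tc
  isolated_inj : ∀ u u' : Fin n, u.val < m → u'.val < m → I.userCategory u = none →
    I.userCategory u' = none → col u = col u' → u = u'
  mem : ∀ (u : Fin n) v, u.val < m → I.userCategory u = some v →
    ∃ S : Clique k, v ∈ S.1 ∧ off S ≤ col u ∧ col u < ptr v S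
  inj : ∀ (u u' : Fin n) v, u.val < m → u'.val < m → I.userCategory u = some v →
    I.userCategory u' = some v → col u = col u' → u = u'
  count : ∀ v, (∑ S : Clique k, if v ∈ S.1 then rem v S else 0) + I.countBefore m (some v)
    = I.countBefore n (some v)

namespace Progress

variable {I : ICDH k n} {off c : Clique k → ℕ} {m : ℕ} {ptr rem : Category k → Clique k → ℕ}
  {tc : ℕ} {col : ℕ → ℕ}

theorem start (hc : I.IsFeasible fun S => (c S : ℤ)) :
    I.Progress off c 0 (fun _ => off) (fun _ => c) (∑ S, c S) col where
  off_le _ _ := le_rfl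
  ptr_add _ _ := rfl
  tc_eq := by simp [countBefore_zero]
  isolated u hu := absurd hu (Nat.not_lt_zero _)
  isolated_inj u _ hu := absurd hu (Nat.not_lt_zero _)
  mem u _ hu := absurd hu (Nat.not_lt_zero _)
  inj u _ _ hu := absurd hu (Nat.not_lt_zero _)
  -- Before any user is served, this is the constraint `Ac = w` at `v`.
  count v := by
    have := congrFun hc.1 v
    rw [weight_eq] at this
    simp only [Matrix.mulVec, dotProduct, constraintMatrix, ite_mul, one_mul, zero_mul] at this
    rw [countBefore_zero, countBefore_self, add_zero]
    zify
    rw [← this]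

/-- By the invariant `count`, the free places for `v` are as many as the users of `v` not yet
served, and user `m` is one of them. Hence the greedy placement cannot fail, whichever cliques were
chosen earlier. -/
theorem exists_rem_ne_zero (h : I.Progress off c m ptr rem tc col) (hm : m < n) {v : Category k}
    (hv : I.userCategory ⟨m, hm⟩ = some v) : ∃ S : Clique k, v ∈ S.1 ∧ rem v S ≠ 0 := by
  classical
  have hmono : ∀ j, m + 1 ≤ j → j ≤ n → I.countBefore (m + 1) (some v)
      ≤ I.countBefore j (some v) := by
    intro j hj
    induction j, hj using Nat.le_induction with
    | base => exact fun _ => le_rfl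
    | succ j hj ih =>
      intro hj'
      rw [I.countBefore_succ (m := j) hj']
      exact (ih (by omega)).trans (Nat.le_add_right _ _)
  have h1 := hmono n hm le_rfl
  rw [I.countBefore_succ hm, if_pos hv, ← h.count v] at h1
  have h2 : (∑ S : Clique k, if v ∈ S.1 then rem v S else 0) ≠ 0 := by omega
  obtain ⟨S, -, hS⟩ := Finset.exists_ne_zero_of_sum_ne_zero h2
  by_cases hvS : v ∈ S.1
  · exact ⟨S, hvS, by simpa [hvS] using hS⟩
  · simp [hvS] at hS

theorem update_of_lt {u : Fin n} (hu : u.val < m) (a : ℕ) : Function.update col m a u = col u :=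
  Function.update_of_ne hu.ne _ _

theorem lt_or_eq (hm : m < n) {u : Fin n} (hu : u.val < m + 1) : u.val < m ∨ u = ⟨m, hm⟩ := by
  by_cases h : u.val = m
  · exact .inr (Fin.ext h)
  · exact .inl (by omega)

theorem step_none (h : I.Progress off c m ptr rem tc col) (hm : m < n)
    (hv : I.userCategory ⟨m, hm⟩ = none) :
    I.Progress off c (m + 1) ptr rem (tc + 1) (Function.update col m tc) where
  off_le := h.off_le
  ptr_add := h.ptr_add
  tc_eq := by rw [I.countBefore_succ hm, if_pos hv, h.tc_eq, add_assoc]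
  isolated u hu hcat := by
    rcases lt_or_eq hm hu with hu | rfl
    · rw [update_of_lt hu]
      have := h.isolated u hu hcat
      omega
    · have := h.tc_eq
      simp
      omega
  isolated_inj u u' hu hu' hcat hcat' he := by
    rcases lt_or_eq hm hu with hu | rfl <;> rcases lt_or_eq hm hu' with hu' | rfl
    · rw [update_of_lt hu, update_of_lt hu'] at he
      exact h.isolated_inj u u' hu hu' hcat hcat' he
    · rw [update_of_lt hu] at he
      have := h.isolated u hu hcat
      simp at he
      omega
    · rw [update_of_lt hu'] at he
      have := h.isolated u' hu' hcat'
      simp at he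
      omega
    · rfl
  mem u v hu hcat := by
    rcases lt_or_eq hm hu with hu | rfl
    · rw [update_of_lt hu]
      exact h.mem u v hu hcat
    · rw [hv] at hcat
      cases hcat
  inj u u' v hu hu' hcat hcat' he := by
    rcases lt_or_eq hm hu with hu | rfl
    · rcases lt_or_eq hm hu' with hu' | rfl
      · rw [update_of_lt hu, update_of_lt hu'] at he
        exact h.inj u u' v hu hu' hcat hcat' he
      · rw [hv] at hcat'
        cases hcat'
    · rw [hv] at hcat
      cases hcat
  count v := by
    rw [I.countBefore_succ hm, if_neg (by rw [hv]; simp), add_zero, h.count]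

open Classical in
theorem step_some (hl : IsLayout off c) (h : I.Progress off c m ptr rem tc col) (hm : m < n)
    {v : Category k} (hv : I.userCategory ⟨m, hm⟩ = some v) {S : Clique k} (hS : v ∈ S.1)
    (hrem : rem v S ≠ 0) :
    I.Progress off c (m + 1) (fun w R => if w = v ∧ R = S then ptr w R + 1 else ptr w R)
      (fun w R => if w = v ∧ R = S then rem w R - 1 else rem w R) tc
      (Function.update col m (ptr v S)) where
  off_le w R := by
    have := h.off_le w R
    split_ifs <;> omega
  ptr_add w R := by
    have := h.ptr_add w R
    split_ifs with hw
    · obtain ⟨rfl, rfl⟩ := hw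
      omega
    · exact this
  tc_eq := by rw [I.countBefore_succ hm, if_neg (by rw [hv]; simp), add_zero, h.tc_eq]
  isolated u hu hcat := by
    rcases lt_or_eq hm hu with hu | rfl
    · rw [update_of_lt hu]
      exact h.isolated u hu hcat
    · rw [hv] at hcat
      cases hcat
  isolated_inj u u' hu hu' hcat hcat' he := by
    rcases lt_or_eq hm hu with hu | rfl
    · rcases lt_or_eq hm hu' with hu' | rfl
      · rw [update_of_lt hu, update_of_lt hu'] at he
        exact h.isolated_inj u u' hu hu' hcat hcat' he
      · rw [hv] at hcat'
        cases hcat'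
    · rw [hv] at hcat
      cases hcat
  mem u w hu hcat := by
    rcases lt_or_eq hm hu with hu | rfl
    · rw [update_of_lt hu]
      obtain ⟨R, h1, h2, h3⟩ := h.mem u w hu hcat
      exact ⟨R, h1, h2, by split_ifs <;> omega⟩
    · rw [hv, Option.some_inj] at hcat
      subst hcat
      exact ⟨S, hS, by simpa using h.off_le v S, by simp⟩
  inj u u' w hu hu' hcat hcat' he := by
    -- An earlier user of `v` in this place would belong to the interval of `S`, as intervals are
    -- disjoint, but the places of `S` used by `v` are below its pointer.
    have key : ∀ x : Fin n, x.val < m → I.userCategory x = some v → col x ≠ ptr v S := by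
      intro x hx hcx hxe
      obtain ⟨R, -, h2, h3⟩ := h.mem x v hx hcx
      have h4 := h.ptr_add v R
      have h5 := h.ptr_add v S
      have h6 := h.off_le v S
      have := hl.disjoint R S (col x) h2 (by omega) (by omega) (by omega)
      subst this
      omega
    rcases lt_or_eq hm hu with hu | rfl <;> rcases lt_or_eq hm hu' with hu' | rfl
    · rw [update_of_lt hu, update_of_lt hu'] at he
      exact h.inj u u' w hu hu' hcat hcat' he
    · rw [hv, Option.some_inj] at hcat'
      subst hcat'
      rw [update_of_lt hu] at he
      simp at he
      exact absurd he (key u hu hcat)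
    · rw [hv, Option.some_inj] at hcat
      subst hcat
      rw [update_of_lt hu'] at he
      simp at he
      exact absurd he.symm (key u' hu' hcat')
    · rfl
  count w := by
    rw [I.countBefore_succ hm, ← h.count w, hv]
    by_cases hw : v = w
    · subst hw
      have h1 : ∑ R : Clique k, (if v ∈ R.1 then rem v R else 0)
          = (∑ R : Clique k, if v ∈ R.1 then
              (if v = v ∧ R = S then rem v R - 1 else rem v R) else 0) + 1 := by
        rw [← Finset.add_sum_erase _ _ (Finset.mem_univ S),
          ← Finset.add_sum_erase (a := S) _ _ (Finset.mem_univ S)]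
        have h2 : ∑ R ∈ Finset.univ.erase S, (if v ∈ R.1 then
              (if v = v ∧ R = S then rem v R - 1 else rem v R) else 0)
            = ∑ R ∈ Finset.univ.erase S, (if v ∈ R.1 then rem v R else 0) :=
          Finset.sum_congr rfl fun R hR => by simp [Finset.ne_of_mem_erase hR]
        rw [h2]
        simp [hS]
        omega
      rw [h1]
      simp
      omega
    · have hw' : ¬ w = v := fun e => hw e.symm
      simp [hw, hw']

theorem isSchedule (h : I.Progress off c n ptr rem tc col) (hl : IsLayout off c)
    (hc : I.IsFeasible fun S => (c S : ℤ)) : I.IsSchedule off c tc col where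
  feasible := hc
  disjoint := hl.disjoint
  le_sum := hl.le_sum
  length := by
    classical
    rw [h.tc_eq, countBefore_self, isolatedUsers_eq]
  isolated u := h.isolated u u.2
  isolated_inj u u' := h.isolated_inj u u' u.2 u'.2
  mem u v hv := by
    obtain ⟨S, h1, h2, h3⟩ := h.mem u v u.2 hv
    have := h.ptr_add v S
    exact ⟨S, h1, h2, by omega⟩
  inj u u' v := h.inj u u' v u.2 u'.2

end Progress

end ICDH

/-! ### Iteration, branching and block transfers in loop-free code -/

namespace RAM

variable {V α : Type}

/-- Run `f a` for the members `a` of a list, one after the other. -/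
def Code.forEach (f : α → Code V) : List α → Code V
  | [] => .skip
  | a :: l => .seq (f a) (forEach f l)

/-- Branch on which of the listed variables are nonzero. -/
def Code.branch : List V → (Set V → Code V) → Code V
  | [], Q => Q ∅
  | v :: l, Q => .ite v (branch l fun T => Q (insert v T)) (branch l Q)

/-- The decision tree knows at each leaf which variables are nonzero, so the code placed there may
depend on this set through an arbitrary, even noncomputable, function. -/
theorem Code.run_branch [DecidableEq V] (l : List V) (Q : Set V → Code V) (s : Store V) :
    (Code.branch l Q).run s = (Q {v | v ∈ l ∧ s.reg v ≠ 0}).run s := by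
  induction l generalizing Q with
  | nil => simp [Code.branch]
  | cons v l ih =>
    simp only [Code.branch, Code.run, ih]
    split_ifs with hv
    · congr 2
      ext w
      simp only [Set.mem_insert_iff, Set.mem_ofPred_eq, List.mem_cons]
      constructor
      · rintro (rfl | h)
        exacts [⟨.inl rfl, hv⟩, ⟨.inr h.1, h.2⟩]
      · rintro ⟨rfl | h, h'⟩
        exacts [.inl rfl, .inr ⟨h, h'⟩]
    · congr 2
      ext w
      simp only [Set.mem_ofPred_eq, List.mem_cons]
      constructor
      · exact fun h => ⟨.inr h.1, h.2⟩
      · rintro ⟨rfl | h, h'⟩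
        exacts [absurd h' hv, ⟨h, h'⟩]

/-- Load consecutive memory cells into the listed variables. -/
def Code.loads (pos one : V) : List V → Code V :=
  Code.forEach fun x => .seq (.load x pos) (.add pos pos one)

/-- Store the listed variables into consecutive memory cells. -/
def Code.stores (pos one : V) : List V → Code V :=
  Code.forEach fun x => .seq (.store pos x) (.add pos pos one)

theorem Code.run_loads [DecidableEq V] {pos one : V} (hne : one ≠ pos) (l : List V)
    (hnd : l.Nodup) (hpos : pos ∉ l) (hone : one ∉ l) (s : Store V) (h1 : s.reg one = 1) :
    ((Code.loads pos one l).run s).mem = s.mem ∧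
    ((Code.loads pos one l).run s).reg pos = s.reg pos + l.length ∧
    (∀ i (h : i < l.length),
      ((Code.loads pos one l).run s).reg l[i] = s.mem (s.reg pos + i)) ∧
    ∀ x, x ∉ l → x ≠ pos → ((Code.loads pos one l).run s).reg x = s.reg x := by
  unfold Code.loads
  induction l generalizing s with
  | nil => simp [Code.forEach, Code.run]
  | cons y l ih =>
    simp only [List.mem_cons, not_or] at hpos hone
    obtain ⟨hy, hnd⟩ := List.nodup_cons.1 hnd
    let s1 := Code.run (.seq (.load y pos) (.add pos pos one)) s
    have hs1 : ∀ x, s1.reg x = if x = pos then s.reg pos + 1 else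
        if x = y then s.mem (s.reg pos) else s.reg x := by
      intro x
      simp [s1, Code.run, Store.setReg_reg, hpos.1, hone.1, h1]
    obtain ⟨i1, i2, i3, i4⟩ := ih hnd hpos.2 hone.2 s1 (by rw [hs1]; simp [hne, hone.1, h1])
    simp only [Code.forEach, Code.run] at i1 i2 i3 i4 ⊢
    refine ⟨i1.trans rfl, i2.trans ?_, ?_, ?_⟩
    · rw [hs1, if_pos rfl, List.length_cons]; omega
    · intro i hi
      cases i with
      | zero =>
        rw [List.getElem_cons_zero]
        refine (i4 y hy (Ne.symm hpos.1)).trans ?_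
        rw [hs1, if_neg (Ne.symm hpos.1), if_pos rfl, add_zero]
      | succ i =>
        rw [List.getElem_cons_succ]
        refine (i3 i (by simpa using hi)).trans ?_
        rw [hs1, if_pos rfl, add_assoc, add_comm 1]
        rfl
    · intro x hx hxp
      simp only [List.mem_cons, not_or] at hx
      refine (i4 x hx.2 hxp).trans ?_
      rw [hs1, if_neg hxp, if_neg hx.1]

theorem Code.run_stores [DecidableEq V] {pos one : V} (hne : one ≠ pos) (l : List V)
    (hpos : pos ∉ l) (s : Store V) (h1 : s.reg one = 1) :
    (∀ x, x ≠ pos → ((Code.stores pos one l).run s).reg x = s.reg x) ∧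
    (∀ q, q < s.reg pos → ((Code.stores pos one l).run s).mem q = s.mem q) ∧
    ∀ i (h : i < l.length),
      ((Code.stores pos one l).run s).mem (s.reg pos + i) = s.reg l[i] := by
  unfold Code.stores
  induction l generalizing s with
  | nil => simp [Code.forEach, Code.run]
  | cons y l ih =>
    simp only [List.mem_cons, not_or] at hpos
    let s1 := Code.run (.seq (.store pos y) (.add pos pos one)) s
    have hs1 : ∀ x, s1.reg x = if x = pos then s.reg pos + 1 else s.reg x := by
      intro x
      simp [s1, Code.run, Store.setReg_reg, h1]
    have hm1 : ∀ q, s1.mem q = if q = s.reg pos then s.reg y else s.mem q := by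
      intro q
      simp [s1, Code.run, Store.setMem_mem]
    obtain ⟨i1, i2, i3⟩ := ih hpos.2 s1 (by rw [hs1]; simp [hne, h1])
    simp only [Code.forEach, Code.run] at i1 i2 i3 ⊢
    refine ⟨fun x hx => (i1 x hx).trans ?_, fun q hq => (i2 q ?_).trans ?_, ?_⟩
    · rw [hs1, if_neg hx]
    · rw [hs1, if_pos rfl]; omega
    · rw [hm1, if_neg hq.ne]
    · intro i hi
      cases i with
      | zero =>
        rw [List.getElem_cons_zero, add_zero]
        refine (i2 _ ?_).trans ?_
        · rw [hs1, if_pos rfl]; omega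
        · rw [hm1, if_pos rfl]
      | succ i =>
        rw [List.getElem_cons_succ]
        have hi' : i < l.length := by simpa using hi
        have hmem : l[i] ∈ l := List.getElem_mem hi'
        have := i3 i hi'
        rw [hs1, if_pos rfl, hs1, if_neg (ne_of_mem_of_not_mem hmem hpos.2), add_assoc,
          add_comm 1] at this
        exact this

end RAM

namespace ICDH

open RAM

variable {k : ℕ}

/-! ### The variables of the program -/

/-- The variables: the number of users, the number of users to come, the current user, the position
of its block, constants and a temporary, the flag of the augmentation loop, the next free
transmission; the bits of the current user, the table of linked pairs, the solution of the integer
program, and for each category and clique the pointer and counter of free transmissions. -/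
inductive Var (k : ℕ) : Type where
  | num | cnt | user | pos | one | zero | tmp | flag | next
  | inC (j : Fin k) | inS (j : Fin k) | link (i j : Fin k)
  | sol (S : Clique k) | ptr (v : Category k) (S : Clique k) | rem (v : Category k) (S : Clique k)

noncomputable instance : DecidableEq (Var k) := Classical.decEq _

theorem exists_registers (k : ℕ) : ∃ ρ : Var k → ℕ, Function.Injective ρ ∧ ρ .num = 0 := by
  let φ : Var k → ℕ ⊕ Fin k ⊕ Fin k ⊕ (Fin k × Fin k) ⊕ Clique k ⊕ (Category k × Clique k) ⊕
      (Category k × Clique k) := fun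
    | .num => .inl 0 | .cnt => .inl 1 | .user => .inl 2 | .pos => .inl 3 | .one => .inl 4
    | .zero => .inl 5 | .tmp => .inl 6 | .flag => .inl 7 | .next => .inl 8
    | .inC j => .inr (.inl j) | .inS j => .inr (.inr (.inl j))
    | .link i j => .inr (.inr (.inr (.inl (i, j))))
    | .sol S => .inr (.inr (.inr (.inr (.inl S))))
    | .ptr v S => .inr (.inr (.inr (.inr (.inr (.inl (v, S))))))
    | .rem v S => .inr (.inr (.inr (.inr (.inr (.inr (v, S))))))
  have hφ : Function.Injective φ := by
    intro x y h
    cases x <;> cases y <;> simp_all [φ]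
  obtain ⟨f, hf⟩ := exists_injective_nat
    (ℕ ⊕ Fin k ⊕ Fin k ⊕ (Fin k × Fin k) ⊕ Clique k ⊕ (Category k × Clique k) ⊕
      (Category k × Clique k))
  -- Register `0` is where the input has `n` and where the length is output; the shift by one
  -- reserves it.
  refine ⟨fun x => if x = .num then 0 else f (φ x) + 1, ?_, if_pos rfl⟩
  intro x y h
  simp only at h
  split_ifs at h with hx hy hy
  · rw [hx, hy]
  · exact hφ (hf (by omega))

/-! ### Reading the bits of a user -/

/-- The variables for the bits of a user, in the order of the input. -/
def userBits (k : ℕ) : List (Var k) :=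
  (List.finRange k).map .inC ++ (List.finRange k).map .inS

/-- Read the bits of the current user. -/
noncomputable def readCode (k : ℕ) : Code (Var k) := Code.loads .pos .one (userBits k)

theorem run_readCode (s : Store (Var k)) (h1 : s.reg .one = 1) :
    ((readCode k).run s).mem = s.mem ∧
    ((readCode k).run s).reg .pos = s.reg .pos + 2 * k ∧
    (∀ j, ((readCode k).run s).reg (.inC j) = s.mem (s.reg .pos + j)) ∧
    (∀ j, ((readCode k).run s).reg (.inS j) = s.mem (s.reg .pos + k + j)) ∧
    ∀ x, x ≠ .pos → (∀ j, x ≠ .inC j) → (∀ j, x ≠ .inS j) →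
      ((readCode k).run s).reg x = s.reg x := by
  have hnd : (userBits k).Nodup := by
    refine List.Nodup.append ?_ ?_ ?_
    · exact (List.nodup_finRange k).map fun i j h => by simpa using h
    · exact (List.nodup_finRange k).map fun i j h => by simpa using h
    · intro x hx hy
      simp only [List.mem_map] at hx hy
      obtain ⟨i, -, rfl⟩ := hx
      obtain ⟨j, -, h⟩ := hy
      cases h
  obtain ⟨h2, h3, h4, h5⟩ := Code.run_loads (pos := Var.pos) (one := Var.one) (by simp)
    (userBits k) hnd (by simp [userBits]) (by simp [userBits]) s h1
  refine ⟨h2, ?_, fun j => ?_, fun j => ?_, fun x hx hC hS => ?_⟩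
  · rw [readCode, h3]
    simp [userBits]
    omega
  · have := h4 j (by simp [userBits]; omega)
    rw [readCode, ← this]
    congr 1
    simp [userBits]
  · have := h4 (k + j) (by simp [userBits])
    rw [readCode, add_assoc, ← this]
    congr 1
    simp [userBits]
  · refine h5 x ?_ hx
    simp only [userBits, List.mem_append, List.mem_map, not_or, not_exists]
    exact ⟨fun j h => hC j h.2.symm, fun j h => hS j h.2.symm⟩

/-- Enter the current user into the table of linked pairs. -/
noncomputable def linkCode (k : ℕ) : Code (Var k) :=
  Code.forEach (fun q : Fin k × Fin k =>
    .ite (.inC q.2) (.ite (.inS q.1) (.const (.link q.1 q.2) 1) .skip) .skip) Finset.univ.toList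

theorem run_linkCode (s : Store (Var k)) :
    ((linkCode k).run s).mem = s.mem ∧
    (∀ i j, ((linkCode k).run s).reg (.link i j) =
      if s.reg (.inC j) ≠ 0 ∧ s.reg (.inS i) ≠ 0 then 1 else s.reg (.link i j)) ∧
    ∀ x, (∀ i j, x ≠ .link i j) → ((linkCode k).run s).reg x = s.reg x := by
  have key : ∀ (l : List (Fin k × Fin k)) (s : Store (Var k)),
      (Code.run (Code.forEach (fun q : Fin k × Fin k => .ite (.inC q.2)
        (.ite (.inS q.1) (.const (.link q.1 q.2) 1) .skip) .skip) l) s).mem = s.mem ∧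
      (∀ i j, (Code.run (Code.forEach (fun q : Fin k × Fin k => .ite (.inC q.2)
        (.ite (.inS q.1) (.const (.link q.1 q.2) 1) .skip) .skip) l) s).reg (.link i j) =
          if (i, j) ∈ l ∧ s.reg (.inC j) ≠ 0 ∧ s.reg (.inS i) ≠ 0 then 1
          else s.reg (.link i j)) ∧
      ∀ x, (∀ i j, x ≠ .link i j) → (Code.run (Code.forEach (fun q : Fin k × Fin k =>
        .ite (.inC q.2) (.ite (.inS q.1) (.const (.link q.1 q.2) 1) .skip) .skip) l) s).reg x
          = s.reg x := by
    intro l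
    induction l with
    | nil => simp [Code.forEach, Code.run]
    | cons q l ih =>
      intro s
      obtain ⟨a, b⟩ := q
      let s1 : Store (Var k) := Code.run (.ite (.inC b)
        (.ite (.inS a) (.const (.link a b) 1) .skip) .skip) s
      have hm : s1.mem = s.mem := by
        simp only [s1, Code.run]
        split_ifs <;> rfl
      have hr : ∀ x, s1.reg x = if x = .link a b ∧ s.reg (.inC b) ≠ 0 ∧ s.reg (.inS a) ≠ 0 then 1
          else s.reg x := by
        intro x
        simp only [s1, Code.run]
        split_ifs <;> simp_all [Store.setReg_reg]
      obtain ⟨i1, i2, i3⟩ := ih s1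
      simp only [Code.forEach, Code.run] at i1 i2 i3 ⊢
      refine ⟨i1.trans hm, fun i j => (i2 i j).trans ?_, fun x hx => (i3 x hx).trans ?_⟩
      · simp only [hr, List.mem_cons, Prod.mk.injEq, Var.link.injEq, reduceCtorEq, false_and,
          if_false]
        by_cases hij : i = a ∧ j = b
        · obtain ⟨rfl, rfl⟩ := hij
          by_cases h : s.reg (.inC j) ≠ 0 ∧ s.reg (.inS i) ≠ 0
          · simp [h]
          · rw [if_neg fun h' => h h'.2, if_neg fun h' => h h'.2, if_neg fun h' => h h'.2]
        · simp [hij]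
      · rw [hr, if_neg fun h => hx a b h.1]
  obtain ⟨h1, h2, h3⟩ := key Finset.univ.toList s
  refine ⟨h1, fun i j => (h2 i j).trans ?_, h3⟩
  simp only [Finset.mem_toList, Finset.mem_univ, true_and]

/-! ### Branching on the category of a user -/

/-- All the variables that determine the category of the current user. -/
noncomputable def categoryBits (k : ℕ) : List (Var k) :=
  userBits k ++ (Finset.univ : Finset (Fin k × Fin k)).toList.map fun q => .link q.1 q.2

open Classical in
/-- The category of the current user, from the set of nonzero bits. -/
noncomputable def categoryOfBits (T : Set (Var k)) : Option (Category k) :=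
  bitCategory (Finset.univ.filter fun j => .inC j ∈ T) (Finset.univ.filter fun j => .inS j ∈ T)
    (Finset.univ.filter fun q => .link q.1 q.2 ∈ T)

/-- Run the code that belongs to the category of the current user. -/
noncomputable def categoryCode (Q : Option (Category k) → Code (Var k)) : Code (Var k) :=
  Code.branch (categoryBits k) fun T => Q (categoryOfBits T)

/-- Both sides evaluate `bitCategory` on the same three finite sets of bits; `userCategory` is
defined through it for this purpose. -/
theorem run_categoryCode {n : ℕ} (I : ICDH k n) (u : Fin n) (Q : Option (Category k) → Code (Var k))
    (s : Store (Var k)) (hC : ∀ j, s.reg (.inC j) ≠ 0 ↔ u ∈ I.C j)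
    (hS : ∀ j, s.reg (.inS j) ≠ 0 ↔ u ∈ I.S j)
    (hL : ∀ i j, s.reg (.link i j) ≠ 0 ↔ (i, j) ∈ I.linkedPairs) :
    (categoryCode Q).run s = (Q (I.userCategory u)).run s := by
  rw [categoryCode, Code.run_branch]
  congr 2
  unfold categoryOfBits userCategory
  congr 1
  · ext j
    simp [categoryBits, userBits, ← hC]
  · ext j
    simp [categoryBits, userBits, ← hS]
  · ext ⟨i, j⟩
    simp [categoryBits, userBits, ← hL]

/-! ### Graver augmentation -/

/-- Run `yes` if the solution stays nonnegative on the listed cliques when `g` is added, and `no`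
otherwise. -/
noncomputable def testCode (g : Clique k → ℤ) (yes no : Code (Var k)) :
    List (Clique k) → Code (Var k)
  | [] => .seq (.const .tmp 0) yes
  | S :: l => .seq (.const .tmp (-g S).toNat) (.seq (.sub .tmp .tmp (.sol S))
      (.ite .tmp (.seq (.const .tmp 0) no) (testCode g yes no l)))

/-- The truncated difference of the negative part of `g S` and the current value is nonzero exactly
when the sum would be negative. The temporary is cleared on either exit, as the scan state demands.
-/
theorem run_testCode (g : Clique k → ℤ) (yes no : Code (Var k)) (l : List (Clique k))
    (s : Store (Var k)) :
    (testCode g yes no l).run s = open Classical in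
      if ∀ S ∈ l, (0 : ℤ) ≤ s.reg (.sol S) + g S then yes.run (s.setReg .tmp 0)
      else no.run (s.setReg .tmp 0) := by
  classical
  have hset : ∀ (s : Store (Var k)) a b, (s.setReg .tmp a).setReg .tmp b = s.setReg .tmp b := by
    intro s a b
    simp [Store.setReg]
  induction l generalizing s with
  | nil => simp [testCode, Code.run]
  | cons S l ih =>
    simp only [testCode, Code.run, ih, hset]
    simp only [Store.setReg_reg, if_true, reduceCtorEq, if_false, List.mem_cons, forall_eq_or_imp]
    by_cases hS : (0 : ℤ) ≤ s.reg (.sol S) + g S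
    · rw [if_neg (by omega)]
      simp [hS]
    · rw [if_pos (by omega)]
      simp [hS]

/-- Add `g` to the solution, on the listed cliques. -/
noncomputable def applyCode (g : Clique k → ℤ) : List (Clique k) → Code (Var k)
  | [] => .const .tmp 0
  | S :: l => .seq (.const .tmp (g S).toNat) (.seq (.add (.sol S) (.sol S) .tmp)
      (.seq (.const .tmp (-g S).toNat) (.seq (.sub (.sol S) (.sol S) .tmp) (applyCode g l))))

/-- The positive part is added before the negative part is subtracted; as the result is nonnegative,
truncation never takes effect. -/
theorem run_applyCode (g : Clique k → ℤ) (l : List (Clique k)) (hl : l.Nodup)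
    (s : Store (Var k)) (h : ∀ S ∈ l, (0 : ℤ) ≤ s.reg (.sol S) + g S) :
    ((applyCode g l).run s).mem = s.mem ∧
    ((applyCode g l).run s).reg .tmp = 0 ∧
    (∀ S ∈ l, (((applyCode g l).run s).reg (.sol S) : ℤ) = s.reg (.sol S) + g S) ∧
    ∀ x, x ≠ .tmp → (∀ S ∈ l, x ≠ .sol S) → ((applyCode g l).run s).reg x = s.reg x := by
  induction l generalizing s with
  | nil =>
    refine ⟨rfl, by simp [applyCode, Code.run, Store.setReg_reg], by simp, fun x hx _ => ?_⟩
    simp [applyCode, Code.run, Store.setReg_reg, hx]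
  | cons R l ih =>
    obtain ⟨hR, hl⟩ := List.nodup_cons.1 hl
    let s1 : Store (Var k) := Code.run (.seq (.const .tmp (g R).toNat)
      (.seq (.add (.sol R) (.sol R) .tmp) (.seq (.const .tmp (-g R).toNat)
      (.sub (.sol R) (.sol R) .tmp)))) s
    have hr : ∀ x, s1.reg x = if x = .sol R then s.reg (.sol R) + (g R).toNat - (-g R).toNat else
        if x = .tmp then (-g R).toNat else s.reg x := by
      intro x
      simp only [s1, Code.run, Store.setReg_reg]
      split_ifs <;> simp_all
    obtain ⟨i1, i2, i3, i4⟩ := ih hl s1 (fun S hS => by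
      have hne : S ≠ R := fun e => hR (e ▸ hS)
      rw [hr, if_neg (by simpa using hne), if_neg (by simp)]
      exact h S (List.mem_cons_of_mem _ hS))
    simp only [applyCode, Code.run] at i1 i2 i3 i4 ⊢
    refine ⟨i1.trans rfl, i2, fun S hS => ?_, fun x hx hx' => ?_⟩
    · rcases List.mem_cons.1 hS with rfl | hS
      · refine (congrArg Nat.cast (i4 (.sol S) (by simp) fun S' hS' e => ?_)).trans ?_
        · simp only [Var.sol.injEq] at e
          exact hR (e ▸ hS')
        · rw [hr, if_pos rfl]
          have := h S (List.mem_cons_self ..)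
          omega
      · have hne : S ≠ R := fun e => hR (e ▸ hS)
        refine (i3 S hS).trans ?_
        rw [hr, if_neg (by simpa using hne), if_neg (by simp)]
    · refine (i4 x hx fun S hS => hx' S (List.mem_cons_of_mem _ hS)).trans ?_
      rw [hr, if_neg (hx' R (List.mem_cons_self ..)), if_neg hx]

/-- Add the first listed vector that keeps the solution nonnegative; clear the flag if there is
none. -/
noncomputable def augmentCode : List (Clique k → ℤ) → Code (Var k)
  | [] => .const .flag 0
  | g :: L => testCode g (applyCode g Finset.univ.toList) (augmentCode L) Finset.univ.toList

theorem run_augmentCode (L : List (Clique k → ℤ)) (s : Store (Var k)) (h0 : s.reg .tmp = 0) :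
    ((∀ g ∈ L, ¬ ∀ S, (0 : ℤ) ≤ s.reg (.sol S) + g S) ∧
      (augmentCode L).run s = s.setReg .flag 0) ∨
    ∃ g ∈ L, (∀ S, (0 : ℤ) ≤ s.reg (.sol S) + g S) ∧ ((augmentCode L).run s).mem = s.mem ∧
      (∀ S, (((augmentCode L).run s).reg (.sol S) : ℤ) = s.reg (.sol S) + g S) ∧
      ∀ x, (∀ S, x ≠ .sol S) → ((augmentCode L).run s).reg x = s.reg x := by
  classical
  have hs : s.setReg .tmp 0 = s := by
    simp [Store.setReg, ← h0]
  induction L with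
  | nil => exact .inl ⟨by simp, rfl⟩
  | cons g L ih =>
    rw [augmentCode, run_testCode, hs]
    simp only [Finset.mem_toList, Finset.mem_univ, true_imp_iff]
    split_ifs with hg
    · right
      obtain ⟨h1, h2, h3, h4⟩ := run_applyCode g Finset.univ.toList (Finset.nodup_toList _) s
        fun S _ => hg S
      refine ⟨g, List.mem_cons_self .., hg, h1, fun S => h3 S (by simp), fun x hx => ?_⟩
      by_cases hxt : x = .tmp
      · rw [hxt, h2, h0]
      · exact h4 x hxt fun S _ => hx S
    · rcases ih with ⟨h1, h2⟩ | ⟨g', hg', h⟩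
      · refine .inl ⟨fun g' hg' => ?_, h2⟩
        rcases List.mem_cons.1 hg' with rfl | hg'
        exacts [hg, h1 g' hg']
      · exact .inr ⟨g', List.mem_cons_of_mem _ hg', h⟩

/-! ### Laying out the transmissions -/

/-- Initialize the pointers and counters of a clique. -/
noncomputable def setupClique (S : Clique k) : List (Category k) → Code (Var k) :=
  Code.forEach fun v => .seq (.add (.ptr v S) .next .zero) (.add (.rem v S) (.sol S) .zero)

theorem run_setupClique (S : Clique k) (l : List (Category k)) (s : Store (Var k))
    (h0 : s.reg .zero = 0) :
    ((setupClique S l).run s).mem = s.mem ∧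
    (∀ v ∈ l, ((setupClique S l).run s).reg (.ptr v S) = s.reg .next ∧
      ((setupClique S l).run s).reg (.rem v S) = s.reg (.sol S)) ∧
    ∀ x, (∀ v ∈ l, x ≠ .ptr v S ∧ x ≠ .rem v S) → ((setupClique S l).run s).reg x = s.reg x := by
  classical
  unfold setupClique
  induction l generalizing s with
  | nil => simp [Code.forEach, Code.run]
  | cons w l ih =>
    let s1 : Store (Var k) := Code.run
      (.seq (.add (.ptr w S) .next .zero) (.add (.rem w S) (.sol S) .zero)) s
    have hr : ∀ x, s1.reg x = if x = .rem w S then s.reg (.sol S) else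
        if x = .ptr w S then s.reg .next else s.reg x := by
      intro x
      simp [s1, Code.run, Store.setReg_reg, h0]
    obtain ⟨i1, i2, i3⟩ := ih s1 (by simp [hr, h0])
    simp only [Code.forEach, Code.run] at i1 i2 i3 ⊢
    refine ⟨i1.trans rfl, fun v hv => ?_, fun x hx => (i3 x fun v hv =>
      hx v (List.mem_cons_of_mem _ hv)).trans ?_⟩
    · by_cases hvl : v ∈ l
      · have := i2 v hvl
        simp only [hr, reduceCtorEq, if_false] at this
        exact this
      · have hvw : v = w := by simpa [hvl] using hv
        subst hvw
        refine ⟨(i3 _ fun v' hv' => ⟨?_, by simp⟩).trans ?_,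
          (i3 _ fun v' hv' => ⟨by simp, ?_⟩).trans ?_⟩
        · simp only [ne_eq, Var.ptr.injEq, and_true]
          rintro rfl
          exact hvl hv'
        · simp [hr]
        · simp only [ne_eq, Var.rem.injEq, and_true]
          rintro rfl
          exact hvl hv'
        · simp [hr]
    · have := hx w (List.mem_cons_self ..)
      rw [hr, if_neg this.2, if_neg this.1]

/-- Give every listed clique an interval of transmissions. -/
noncomputable def setupCode : List (Clique k) → Code (Var k) :=
  Code.forEach fun S => .seq (setupClique S Finset.univ.toList) (.add .next .next (.sol S))

/-- The offset of a clique is the value of the running counter when its turn comes, so consecutive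
intervals abut without overlapping and end at the total. -/
theorem run_setupCode (l : List (Clique k)) (hl : l.Nodup) (s : Store (Var k))
    (h0 : s.reg .zero = 0) :
    ((setupCode l).run s).mem = s.mem ∧
    ((setupCode l).run s).reg .next = s.reg .next + (l.map fun S => s.reg (.sol S)).sum ∧
    (∃ off : Clique k → ℕ,
      (∀ S ∈ l, ∀ v, ((setupCode l).run s).reg (.ptr v S) = off S ∧
        ((setupCode l).run s).reg (.rem v S) = s.reg (.sol S)) ∧
      (∀ S ∈ l, s.reg .next ≤ off S ∧
        off S + s.reg (.sol S) ≤ s.reg .next + (l.map fun S => s.reg (.sol S)).sum) ∧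
      ∀ S ∈ l, ∀ S' ∈ l, ∀ x, off S ≤ x → x < off S + s.reg (.sol S) → off S' ≤ x →
        x < off S' + s.reg (.sol S') → S = S') ∧
    ∀ x, x ≠ .next → (∀ S ∈ l, ∀ v, x ≠ .ptr v S ∧ x ≠ .rem v S) →
      ((setupCode l).run s).reg x = s.reg x := by
  classical
  unfold setupCode
  induction l generalizing s with
  | nil => simp [Code.forEach, Code.run]
  | cons R l ih =>
    obtain ⟨hR, hl⟩ := List.nodup_cons.1 hl
    let s1 : Store (Var k) := Code.run
      (.seq (setupClique R Finset.univ.toList) (.add .next .next (.sol R))) s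
    obtain ⟨c1, c2, c3⟩ := run_setupClique R Finset.univ.toList s h0
    have hm : s1.mem = s.mem := c1
    have hr : ∀ x, s1.reg x = if x = .next then s.reg .next + s.reg (.sol R) else
        ((setupClique R Finset.univ.toList).run s).reg x := by
      intro x
      simp only [s1, Code.run, Store.setReg_reg]
      rw [c3 .next (by simp), c3 (.sol R) (by simp)]
    have hsol : ∀ S, s1.reg (.sol S) = s.reg (.sol S) := fun S => by
      rw [hr, if_neg (by simp), c3 _ (by simp)]
    have hnext : s1.reg .next = s.reg .next + s.reg (.sol R) := by rw [hr, if_pos rfl]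
    obtain ⟨i1, i2, ⟨off, i3, i4, i5⟩, i6⟩ := ih hl s1
      (by rw [hr, if_neg (by simp), c3 _ (by simp), h0])
    simp only [hsol, hnext] at i2 i3 i4 i5
    have hmap : s.reg .next + ((R :: l).map fun S => s.reg (.sol S)).sum =
        s.reg .next + s.reg (.sol R) + (l.map fun S => s.reg (.sol S)).sum := by
      simp [add_assoc]
    rw [hmap]
    simp only [Code.forEach, Code.run] at i1 i2 i3 i6 ⊢
    refine ⟨i1.trans hm, i2, ⟨Function.update off R (s.reg .next), ?_, ?_, ?_⟩, ?_⟩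
    · intro S hS v
      rcases List.mem_cons.1 hS with rfl | hS
      · have hne : ∀ S' ∈ l, S ≠ S' := fun S' hS' e => hR (e ▸ hS')
        rw [Function.update_self]
        refine ⟨(i6 (.ptr v S) (by simp) fun S' hS' w => ?_).trans ?_,
          (i6 (.rem v S) (by simp) fun S' hS' w => ?_).trans ?_⟩
        · simp [hne S' hS']
        · rw [hr, if_neg (by simp), (c2 v (by simp)).1]
        · simp [hne S' hS']
        · rw [hr, if_neg (by simp), (c2 v (by simp)).2]
      · have hne : S ≠ R := fun e => hR (e ▸ hS)
        rw [Function.update_of_ne hne]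
        exact i3 S hS v
    · intro S hS
      rcases List.mem_cons.1 hS with rfl | hS
      · rw [Function.update_self]
        omega
      · have hne : S ≠ R := fun e => hR (e ▸ hS)
        rw [Function.update_of_ne hne]
        have := i4 S hS
        omega
    · intro S hS S' hS' x h1 h2 h3 h4
      by_cases hSR : S = R <;> by_cases hSR' : S' = R
      · rw [hSR, hSR']
      · subst hSR
        rw [Function.update_self] at h1 h2
        rw [Function.update_of_ne hSR'] at h3
        have := i4 S' (List.mem_of_ne_of_mem hSR' hS')
        omega
      · subst hSR'
        rw [Function.update_self] at h3 h4
        rw [Function.update_of_ne hSR] at h1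
        have := i4 S (List.mem_of_ne_of_mem hSR hS)
        omega
      · rw [Function.update_of_ne hSR] at h1 h2
        rw [Function.update_of_ne hSR'] at h3 h4
        exact i5 S (List.mem_of_ne_of_mem hSR hS) S' (List.mem_of_ne_of_mem hSR' hS') x h1 h2 h3 h4
    · intro x hx hx'
      refine (i6 x hx fun S hS => hx' S (List.mem_cons_of_mem _ hS)).trans ?_
      rw [hr, if_neg hx, c3 x fun v _ => hx' R (List.mem_cons_self ..) v]

/-! ### Serving a user -/

/-- Serve the current user, of category `v`, from the first listed clique with a free
transmission. -/
noncomputable def placeCode (v : Category k) : List (Clique k) → Code (Var k)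
  | [] => .skip
  | S :: l => .ite (.rem v S)
      (.seq (.store .user (.ptr v S))
        (.seq (.add (.ptr v S) (.ptr v S) .one) (.sub (.rem v S) (.rem v S) .one)))
      (placeCode v l)

theorem run_placeCode (v : Category k) (l : List (Clique k)) (s : Store (Var k))
    (h1 : s.reg .one = 1) (h : ∃ S ∈ l, s.reg (.rem v S) ≠ 0) :
    ∃ S ∈ l, s.reg (.rem v S) ≠ 0 ∧ (placeCode v l).run s =
      ((s.setMem (s.reg .user) (s.reg (.ptr v S))).setReg (.ptr v S)
        (s.reg (.ptr v S) + 1)).setReg (.rem v S) (s.reg (.rem v S) - 1) := by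
  induction l with
  | nil => simp at h
  | cons R l ih =>
    by_cases hR : s.reg (.rem v R) = 0
    · obtain ⟨S, hS, hS'⟩ := h
      have hS2 : S ∈ l := by
        rcases List.mem_cons.1 hS with rfl | hS
        exacts [absurd hR hS', hS]
      obtain ⟨T, hT, hT1, hT2⟩ := ih ⟨S, hS2, hS'⟩
      refine ⟨T, List.mem_cons_of_mem _ hT, hT1, ?_⟩
      rw [placeCode, Code.run, if_neg (by simpa using hR), hT2]
    · refine ⟨R, List.mem_cons_self .., hR, ?_⟩
      rw [placeCode, Code.run, if_pos hR]
      simp [Code.run, Store.setReg_reg, h1]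

end ICDH

namespace ICDH

open RAM

variable {k : ℕ}

/-! ### Bounds -/

/-- Summing the constraints counts `c S` with the factor `|S| ≥ 1`, and the weights count each user
at most once. This bounds both the stored values and the number of augmentations. -/
theorem IsFeasible.sum_le {n : ℕ} {I : ICDH k n} {c : Clique k → ℤ} (hc : I.IsFeasible c) :
    ∑ S, c S ≤ n := by
  classical
  have h1 : ∑ v, I.weight v ≤ n := by
    have h := I.sum_countBefore_le le_rfl
    simp only [weight_eq]
    simp only [countBefore_self] at h
    exact_mod_cast h
  have h2 : ∑ v, I.weight v = ∑ S : Clique k, (S.1.card : ℤ) * c S := by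
    rw [← hc.1]
    simp only [Matrix.mulVec, dotProduct, constraintMatrix]
    rw [Finset.sum_comm]
    refine Finset.sum_congr rfl fun S _ => ?_
    rw [← Finset.sum_mul]
    simp
  refine le_trans (Finset.sum_le_sum fun S _ => ?_) (h2.symm.trans_le h1)
  have h3 : (1 : ℤ) ≤ S.1.card := by exact_mod_cast S.2.1.card_pos
  have h4 := hc.2 S
  simp only [Pi.zero_apply] at h4
  nlinarith

/-! ### The input -/

theorem block_eq {K u u' a b : ℕ} (ha : a < K) (hb : b < K) (h : K * u + a = K * u' + b) :
    u = u' ∧ a = b := by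
  have hK : 0 < K := by omega
  have h1 : (K * u + a) / K = u := by
    rw [Nat.mul_add_div hK, Nat.div_eq_of_lt ha, add_zero]
  have h2 : (K * u' + b) / K = u' := by
    rw [Nat.mul_add_div hK, Nat.div_eq_of_lt hb, add_zero]
  have h3 : u = u' := by rw [← h1, h, h2]
  subst h3
  exact ⟨rfl, by omega⟩

theorem input_mem_C {n : ℕ} (I : ICDH k n) (u : Fin n) (j : Fin k) :
    I.input.mem (2 * k * u + j) = open Classical in if u ∈ I.C j then 1 else 0 := by
  classical
  simp only [input]
  congr 1
  refine propext ⟨?_, fun h => ⟨u, j, .inl ⟨rfl, h⟩⟩⟩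
  rintro ⟨u', j', ⟨h, h'⟩ | ⟨h, h'⟩⟩
  · obtain ⟨h1, h2⟩ := block_eq (by omega) (by omega) h
    rwa [Fin.ext h1, Fin.ext h2]
  · rw [add_assoc] at h
    obtain ⟨h1, h2⟩ := block_eq (by omega) (by omega) h
    omega

theorem input_mem_S {n : ℕ} (I : ICDH k n) (u : Fin n) (j : Fin k) :
    I.input.mem (2 * k * u + k + j) = open Classical in if u ∈ I.S j then 1 else 0 := by
  classical
  simp only [input]
  congr 1
  refine propext ⟨?_, fun h => ⟨u, j, .inr ⟨rfl, h⟩⟩⟩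
  rintro ⟨u', j', ⟨h, h'⟩ | ⟨h, h'⟩⟩
  · rw [add_assoc] at h
    obtain ⟨h1, h2⟩ := block_eq (by omega) (by omega) h
    omega
  · rw [add_assoc, add_assoc] at h
    obtain ⟨h1, h2⟩ := block_eq (by omega) (by omega) h
    have h3 : j = j' := Fin.ext (by omega)
    rwa [Fin.ext h1, h3]

theorem input_mem_le {n : ℕ} (I : ICDH k n) (p : ℕ) : I.input.mem p ≤ 1 := by
  simp only [input]
  split_ifs <;> omega

/-! ### Scanning the users -/

/-- The variables that a scan of the users leaves alone. -/
def Var.IsData : Var k → Prop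
  | .flag | .next | .link _ _ | .sol _ | .ptr _ _ | .rem _ _ => True
  | _ => False

/-- The state of a scan of `n` users after `m` of them, with the pointer to the blocks at `p`. -/
structure Scan (s : Store (Var k)) (n m p : ℕ) : Prop where
  le : m ≤ n
  num : s.reg .num = n
  user : s.reg .user = m
  cnt : s.reg .cnt = n - m
  pos : s.reg .pos = p
  one : s.reg .one = 1
  zero : s.reg .zero = 0
  tmp : s.reg .tmp = 0
  inC : ∀ j, s.reg (.inC j) ≤ 1
  inS : ∀ j, s.reg (.inS j) ≤ 1

/-- The states agree except for the state of the scan. -/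
def SameData (s s' : Store (Var k)) : Prop :=
  s'.mem = s.mem ∧ ∀ x : Var k, x.IsData → s'.reg x = s.reg x

theorem Scan.congr {s s' : Store (Var k)} {n m p : ℕ} (h : Scan s n m p)
    (h' : ∀ x : Var k, ¬ x.IsData → s'.reg x = s.reg x) : Scan s' n m p where
  le := h.le
  num := by rw [h' _ (by simp [Var.IsData]), h.num]
  user := by rw [h' _ (by simp [Var.IsData]), h.user]
  cnt := by rw [h' _ (by simp [Var.IsData]), h.cnt]
  pos := by rw [h' _ (by simp [Var.IsData]), h.pos]
  one := by rw [h' _ (by simp [Var.IsData]), h.one]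
  zero := by rw [h' _ (by simp [Var.IsData]), h.zero]
  tmp := by rw [h' _ (by simp [Var.IsData]), h.tmp]
  inC j := by rw [h' _ (by simp [Var.IsData])]; exact h.inC j
  inS j := by rw [h' _ (by simp [Var.IsData])]; exact h.inS j

/-- The position `2 * k * m` accounts for the summand `2 * k` of the constant, the data and the
memory for the `2`. -/
theorem Scan.bounded {s : Store (Var k)} {n m : ℕ} (h : Scan s n m (2 * k * m))
    (hreg : ∀ x : Var k, x.IsData → s.reg x ≤ 2 * (n + 1)) (hmem : ∀ p, s.mem p ≤ 2 * (n + 1)) :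
    s.Bounded ((2 * k + 2) * (n + 1)) := by
  have hle : 2 * (n + 1) ≤ (2 * k + 2) * (n + 1) := Nat.mul_le_mul_right _ (by omega)
  have hm := h.le
  refine ⟨fun x => ?_, fun p => (hmem p).trans hle⟩
  by_cases hx : x.IsData
  · exact (hreg x hx).trans hle
  · cases x <;> simp only [Var.IsData, not_true_eq_false] at hx
    · rw [h.num]; omega
    · rw [h.cnt]; omega
    · rw [h.user]; omega
    · rw [h.pos]
      exact Nat.mul_le_mul (by omega) (by omega)
    · rw [h.one]; omega
    · rw [h.zero]; omega
    · rw [h.tmp]; omega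
    · exact (h.inC _).trans (by omega)
    · exact (h.inS _).trans (by omega)

/-- Begin a scan. -/
def startCode (k : ℕ) : Code (Var k) :=
  .seq (.const .one 1) (.seq (.add .cnt .num .zero) (.seq (.const .user 0) (.const .pos 0)))

theorem run_startCode {s : Store (Var k)} {n : ℕ} (hnum : s.reg .num = n) (h0 : s.reg .zero = 0)
    (ht : s.reg .tmp = 0) (hC : ∀ j, s.reg (.inC j) ≤ 1) (hS : ∀ j, s.reg (.inS j) ≤ 1) :
    Scan ((startCode k).run s) n 0 (2 * k * 0) ∧ SameData s ((startCode k).run s) := by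
  have hr : ∀ x, ((startCode k).run s).reg x = if x = .pos then 0 else if x = .user then 0 else
      if x = .cnt then n else if x = .one then 1 else s.reg x := by
    intro x
    simp [startCode, Code.run, Store.setReg_reg, hnum, h0]
  refine ⟨⟨Nat.zero_le _, ?_, ?_, ?_, ?_, ?_, ?_, ?_, fun j => ?_, fun j => ?_⟩, rfl, ?_⟩
  any_goals simp [hr, ht, h0, hC, hS, hnum]
  · intro x hx
    cases x <;> simp [Var.IsData] at hx ⊢

/-- Pass on to the next user. -/
def advanceCode (k : ℕ) : Code (Var k) :=
  .seq (.add .user .user .one) (.sub .cnt .cnt .one)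

theorem run_advanceCode {s : Store (Var k)} {n m p : ℕ} (h : Scan s n m p) (hm : m < n) :
    Scan ((advanceCode k).run s) n (m + 1) p ∧ SameData s ((advanceCode k).run s) := by
  have hr : ∀ x, ((advanceCode k).run s).reg x = if x = .cnt then n - (m + 1) else
      if x = .user then m + 1 else s.reg x := by
    intro x
    simp [advanceCode, Code.run, Store.setReg_reg, h.one, h.user, h.cnt, Nat.sub_sub]
  refine ⟨⟨hm, ?_, ?_, ?_, ?_, ?_, ?_, ?_, fun j => ?_, fun j => ?_⟩, rfl, ?_⟩
  any_goals simp [hr, h.num, h.pos, h.one, h.zero, h.tmp, h.inC, h.inS]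
  · intro x hx
    cases x <;> simp [Var.IsData] at hx ⊢

-- Only the cells from `m` on have to hold the input: the block of user `m` starts at `2 * k * m ≥
-- m` if `k > 0`, and for `k = 0` there is nothing to read. The third scan may therefore overwrite
-- cell `m` with the transmission of user `m`.
open Classical in
theorem run_readCode_of_scan {n : ℕ} (I : ICDH k n) {s : Store (Var k)} {m : ℕ}
    (h : Scan s n m (2 * k * m)) (hm : m < n) (hmem : ∀ x, m ≤ x → s.mem x = I.input.mem x) :
    Scan ((readCode k).run s) n m (2 * k * (m + 1)) ∧ SameData s ((readCode k).run s) ∧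
    (∀ j, ((readCode k).run s).reg (.inC j) = if (⟨m, hm⟩ : Fin n) ∈ I.C j then 1 else 0) ∧
    ∀ j, ((readCode k).run s).reg (.inS j) = if (⟨m, hm⟩ : Fin n) ∈ I.S j then 1 else 0 := by
  obtain ⟨h1, h2, h3, h4, h5⟩ := run_readCode s h.one
  have hle : 0 < k → m ≤ 2 * k * m := fun hk => Nat.le_mul_of_pos_left m (by omega)
  have hC : ∀ j, ((readCode k).run s).reg (.inC j)
      = if (⟨m, hm⟩ : Fin n) ∈ I.C j then 1 else 0 := by
    intro j
    have := hle j.pos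
    rw [h3, h.pos, hmem _ (by omega), ← I.input_mem_C]
  have hS : ∀ j, ((readCode k).run s).reg (.inS j)
      = if (⟨m, hm⟩ : Fin n) ∈ I.S j then 1 else 0 := by
    intro j
    have := hle j.pos
    rw [h4, h.pos, hmem _ (by omega), ← I.input_mem_S]
  refine ⟨⟨h.le, ?_, ?_, ?_, ?_, ?_, ?_, ?_, fun j => ?_, fun j => ?_⟩, ⟨h1, ?_⟩, hC, hS⟩
  · rw [h5 _ (by simp) (by simp) (by simp), h.num]
  · rw [h5 _ (by simp) (by simp) (by simp), h.user]
  · rw [h5 _ (by simp) (by simp) (by simp), h.cnt]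
  · rw [h2, h.pos]; ring
  · rw [h5 _ (by simp) (by simp) (by simp), h.one]
  · rw [h5 _ (by simp) (by simp) (by simp), h.zero]
  · rw [h5 _ (by simp) (by simp) (by simp), h.tmp]
  · rw [hC]; split_ifs <;> omega
  · rw [hS]; split_ifs <;> omega
  · intro x hx
    cases x <;> simp only [Var.IsData] at hx
    all_goals exact h5 _ (by simp) (by simp) (by simp)

theorem Scan.lt {s : Store (Var k)} {n m p : ℕ} (h : Scan s n m p) (hc : s.reg .cnt ≠ 0) :
    m < n := by
  have := h.cnt
  omega

theorem Scan.eq {s : Store (Var k)} {n m p : ℕ} (h : Scan s n m p) (hc : s.reg .cnt = 0) :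
    m = n := by
  have := h.cnt
  have := h.le
  omega

/-! ### First scan: the table of linked pairs -/

open Classical in
/-- The table holds the pairs linked by the first `m` users. -/
structure LinkInv (x : Σ n, ICDH k n) (m : ℕ) (s : Store (Var k)) : Prop where
  scan : Scan s x.1 m (2 * k * m)
  mem : s.mem = x.2.input.mem
  flag : s.reg .flag = 0
  next : s.reg .next = 0
  sol : ∀ S, s.reg (.sol S) = 0
  link : ∀ i j, s.reg (.link i j) =
    if ∃ u : Fin x.1, u.val < m ∧ u ∈ x.2.C j ∧ u ∈ x.2.S i then 1 else 0
  free : ∀ v S, s.reg (.ptr v S) = 0 ∧ s.reg (.rem v S) = 0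

theorem LinkInv.start (x : Σ n, ICDH k n) {s : Store (Var k)}
    (hs : s = ⟨fun v => if v = .num then x.1 else 0, x.2.input.mem⟩) :
    LinkInv x 0 ((startCode k).run s) := by
  subst hs
  obtain ⟨h1, h2, h3⟩ := run_startCode (k := k)
    (s := ⟨fun v => if v = .num then x.1 else 0, x.2.input.mem⟩) (n := x.1) (by simp) (by simp)
    (by simp) (by simp) (by simp)
  refine ⟨h1, h2, ?_, ?_, fun S => ?_, fun i j => ?_, fun v S => ⟨?_, ?_⟩⟩
  all_goals rw [h3 _ (by simp [Var.IsData])]; simp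

/-- The body of the first scan. -/
noncomputable def linkBody (k : ℕ) : Code (Var k) :=
  .seq (readCode k) (.seq (linkCode k) (advanceCode k))

theorem LinkInv.step {x : Σ n, ICDH k n} {m : ℕ} {s : Store (Var k)} (h : LinkInv x m s)
    (hm : m < x.1) : LinkInv x (m + 1) ((linkBody k).run s) := by
  classical
  obtain ⟨a1, ⟨a2, a3⟩, a4, a5⟩ := run_readCode_of_scan x.2 h.scan hm fun p _ => by rw [h.mem]
  obtain ⟨b1, b2, b3⟩ := run_linkCode ((readCode k).run s)
  obtain ⟨c1, c2, c3⟩ := run_advanceCode (a1.congr fun v hv => b3 v fun i j e => by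
    subst e
    simp [Var.IsData] at hv) hm
  have key : ∀ v : Var k, v.IsData → (∀ i j, v ≠ .link i j) →
      ((linkBody k).run s).reg v = s.reg v := fun v hv hv' => by
    rw [← a3 v hv, ← b3 v hv', ← c3 v hv]
    rfl
  refine ⟨c1, (c2.trans (b1.trans a2)).trans h.mem, ?_, ?_, fun S => ?_, fun i j => ?_,
    fun v S => ⟨?_, ?_⟩⟩
  · rw [key _ (by simp [Var.IsData]) (by simp), h.flag]
  · rw [key _ (by simp [Var.IsData]) (by simp), h.next]
  · rw [key _ (by simp [Var.IsData]) (by simp), h.sol]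
  · refine (c3 _ (by simp [Var.IsData])).trans ((b2 i j).trans ?_)
    rw [a3 (.link i j) (by simp [Var.IsData]), h.link, a4, a5]
    by_cases hu : (⟨m, hm⟩ : Fin x.1) ∈ x.2.C j ∧ (⟨m, hm⟩ : Fin x.1) ∈ x.2.S i
    · rw [if_pos (by simp [hu.1, hu.2]), if_pos ⟨⟨m, hm⟩, Nat.lt_succ_self m, hu⟩]
    · rw [if_neg (by simpa using hu)]
      congr 1
      refine propext ⟨fun ⟨u, h1, h2⟩ => ⟨u, by omega, h2⟩, fun ⟨u, h1, h2⟩ => ⟨u, ?_, h2⟩⟩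
      by_contra hlt
      have : u = ⟨m, hm⟩ := Fin.ext (by simp; omega)
      exact hu (this ▸ h2)
  · rw [key _ (by simp [Var.IsData]) (by simp), (h.free v S).1]
  · rw [key _ (by simp [Var.IsData]) (by simp), (h.free v S).2]

/-! ### Second scan: the weights -/

open Classical in
/-- The table of linked pairs is complete. -/
def LinksKnown {n : ℕ} (I : ICDH k n) (s : Store (Var k)) : Prop :=
  ∀ i j, s.reg (.link i j) = if (i, j) ∈ I.linkedPairs then 1 else 0

theorem LinksKnown.le {n : ℕ} {I : ICDH k n} {s : Store (Var k)} (h : LinksKnown I s)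
    (i j : Fin k) : s.reg (.link i j) ≤ 1 := by
  rw [h i j]
  split_ifs <;> omega

theorem LinksKnown.congr {n : ℕ} {I : ICDH k n} {s s' : Store (Var k)} (h : LinksKnown I s)
    (h' : ∀ i j, s'.reg (.link i j) = s.reg (.link i j)) : LinksKnown I s' :=
  fun i j => (h' i j).trans (h i j)

/-- The first `m` users are counted. -/
structure CountInv (x : Σ n, ICDH k n) (m : ℕ) (s : Store (Var k)) : Prop where
  scan : Scan s x.1 m (2 * k * m)
  mem : s.mem = x.2.input.mem
  flag : s.reg .flag = 0
  next : s.reg .next = 0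
  link : LinksKnown x.2 s
  sol : ∀ v, s.reg (.sol (singletonClique v)) = x.2.countBefore m (some v)
  sol_zero : ∀ S, (∀ v, S ≠ singletonClique v) → s.reg (.sol S) = 0
  free : ∀ v S, s.reg (.ptr v S) = 0 ∧ s.reg (.rem v S) = 0

theorem CountInv.start {x : Σ n, ICDH k n} {s : Store (Var k)} (h : LinkInv x x.1 s) :
    CountInv x 0 ((startCode k).run s) := by
  classical
  obtain ⟨h1, h2, h3⟩ := run_startCode h.scan.num h.scan.zero h.scan.tmp h.scan.inC h.scan.inS
  refine ⟨h1, h2.trans h.mem, ?_, ?_, fun i j => ?_, fun v => ?_, fun S _ => ?_,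
    fun v S => ⟨?_, ?_⟩⟩
  · rw [h3 _ (by simp [Var.IsData]), h.flag]
  · rw [h3 _ (by simp [Var.IsData]), h.next]
  · rw [h3 _ (by simp [Var.IsData]), h.link]
    simp [linkedPairs]
  · rw [h3 _ (by simp [Var.IsData]), h.sol, countBefore_zero]
  · rw [h3 _ (by simp [Var.IsData]), h.sol]
  · rw [h3 _ (by simp [Var.IsData]), (h.free v S).1]
  · rw [h3 _ (by simp [Var.IsData]), (h.free v S).2]

/-- The body of a scan that treats the users by their categories. -/
noncomputable def scanBody (Q : Option (Category k) → Code (Var k)) : Code (Var k) :=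
  .seq (readCode k) (.seq (categoryCode Q) (advanceCode k))

/-- Isolates the state `s'` between reading the bits and advancing, so that each scan only has to
analyse the code for one category, run from a state with the data of `s`. -/
theorem run_scanBody {n : ℕ} (I : ICDH k n) {s : Store (Var k)} {m : ℕ}
    (Q : Option (Category k) → Code (Var k)) (h : Scan s n m (2 * k * m)) (hm : m < n)
    (hmem : ∀ x, m ≤ x → s.mem x = I.input.mem x) (hlink : LinksKnown I s)
    (hQ : ∀ s' x, ¬ Var.IsData x →
      ((Q (I.userCategory ⟨m, hm⟩)).run s').reg x = s'.reg x) :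
    ∃ s', Scan s' n m (2 * k * (m + 1)) ∧ SameData s s' ∧
      Scan ((scanBody Q).run s) n (m + 1) (2 * k * (m + 1)) ∧
      SameData ((Q (I.userCategory ⟨m, hm⟩)).run s') ((scanBody Q).run s) := by
  classical
  obtain ⟨a1, a2, a4, a5⟩ := run_readCode_of_scan I h hm hmem
  refine ⟨(readCode k).run s, a1, a2, ?_⟩
  have hcat := run_categoryCode I ⟨m, hm⟩ Q ((readCode k).run s) (by simp [a4]) (by simp [a5])
    fun i j => by rw [a2.2 _ (by simp [Var.IsData]), hlink]; simp
  have := run_advanceCode (a1.congr fun v hv => hQ ((readCode k).run s) v hv) hm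
  simpa only [scanBody, Code.run, hcat] using this

/-- Count a user. -/
noncomputable def countCode : Option (Category k) → Code (Var k)
  | none => .skip
  | some v => .add (.sol (singletonClique v)) (.sol (singletonClique v)) .one

theorem CountInv.step {x : Σ n, ICDH k n} {m : ℕ} {s : Store (Var k)} (h : CountInv x m s)
    (hm : m < x.1) : CountInv x (m + 1) ((scanBody countCode).run s) := by
  classical
  obtain ⟨s', a1, a2, a3, a4⟩ := run_scanBody x.2 countCode h.scan hm (fun p _ => by rw [h.mem])
    h.link (by
      intro s' v hv
      cases x.2.userCategory ⟨m, hm⟩ with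
      | none => rfl
      | some w =>
        simp only [countCode, Code.run, Store.setReg_reg]
        rw [if_neg]
        rintro rfl
        simp [Var.IsData] at hv)
  have hr : ∀ y : Var k, y.IsData → ((scanBody countCode).run s).reg y =
      s.reg y + if ∃ v, x.2.userCategory ⟨m, hm⟩ = some v ∧ y = .sol (singletonClique v)
        then 1 else 0 := by
    intro y hy
    rw [a4.2 y hy, ← a2.2 y hy]
    cases x.2.userCategory ⟨m, hm⟩ with
    | none => simp [countCode, Code.run]
    | some w =>
      simp only [countCode, Code.run, Store.setReg_reg, a1.one, Option.some_inj]
      by_cases hyw : y = .sol (singletonClique w)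
      · rw [if_pos hyw, if_pos ⟨w, rfl, hyw⟩, hyw]
      · rw [if_neg hyw, if_neg, add_zero]
        rintro ⟨v, rfl, e⟩
        exact hyw e
  refine ⟨a3, ?_, ?_, ?_, h.link.congr fun i j => ?_, fun v => ?_, fun S hS => ?_,
    fun v S => ⟨?_, ?_⟩⟩
  · rw [a4.1, ← h.mem, ← a2.1]
    cases x.2.userCategory ⟨m, hm⟩ <;> rfl
  · rw [hr _ (by simp [Var.IsData]), h.flag]; simp
  · rw [hr _ (by simp [Var.IsData]), h.next]; simp
  · rw [hr _ (by simp [Var.IsData])]; simp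
  · rw [hr _ (by simp [Var.IsData]), h.sol, x.2.countBefore_succ hm]
    simp only [Var.sol.injEq, singletonClique_injective.eq_iff]
    simp
  · rw [hr _ (by simp [Var.IsData]), h.sol_zero S hS]
    simp [hS]
  · rw [hr _ (by simp [Var.IsData]), (h.free v S).1]; simp
  · rw [hr _ (by simp [Var.IsData]), (h.free v S).2]; simp

/-! ### The augmentation loop -/

/-- The solution that is held by the variables. -/
def solution (s : Store (Var k)) (S : Clique k) : ℤ := s.reg (.sol S)

/-- The solution is feasible and reached by Graver augmentation, and optimal once the flag is
cleared. -/
structure AugmentInv (x : Σ n, ICDH k n) (s : Store (Var k)) : Prop where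
  scan : Scan s x.1 x.1 (2 * k * x.1)
  mem : s.mem = x.2.input.mem
  flag : s.reg .flag ≤ 1
  next : s.reg .next = 0
  link : LinksKnown x.2 s
  feasible : x.2.IsFeasible (solution s)
  reach : Relation.ReflTransGen Augments x.2.initialSolution (solution s)
  optimal : s.reg .flag = 0 → x.2.IsOptimalSolution (solution s)
  free : ∀ v S, s.reg (.ptr v S) = 0 ∧ s.reg (.rem v S) = 0

theorem AugmentInv.start {x : Σ n, ICDH k n} {s : Store (Var k)} (h : CountInv x x.1 s) :
    AugmentInv x ((Code.const .flag 1).run s) := by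
  classical
  have hr : ∀ y, ((Code.const .flag 1).run s).reg y = if y = .flag then 1 else s.reg y := by
    intro y
    simp [Code.run, Store.setReg_reg]
  have hsol : solution ((Code.const .flag 1).run s) = x.2.initialSolution := by
    ext S
    rw [solution, hr, if_neg (by simp)]
    by_cases hS : ∃ v, S = singletonClique v
    · obtain ⟨v, rfl⟩ := hS
      rw [h.sol, initialSolution_singletonClique, weight_eq, countBefore_self]
    · push Not at hS
      rw [h.sol_zero S hS, x.2.initialSolution_eq_zero hS, Nat.cast_zero]
  refine ⟨h.scan.congr fun y hy => ?_, h.mem, ?_, ?_, h.link.congr fun i j => ?_, ?_, ?_, ?_,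
    fun v S => ⟨?_, ?_⟩⟩
  · rw [hr, if_neg]
    rintro rfl
    simp [Var.IsData] at hy
  · rw [hr, if_pos rfl]
  · rw [hr, if_neg (by simp), h.next]
  · rw [hr, if_neg (by simp)]
  · rw [hsol]
    exact x.2.isFeasible_initialSolution
  · rw [hsol]
  · rw [hr, if_pos rfl]
    simp
  · rw [hr, if_neg (by simp), (h.free v S).1]
  · rw [hr, if_neg (by simp), (h.free v S).2]

/-- The elements of the Graver basis that decrease the objective. -/
noncomputable def descents (k : ℕ) : List (Clique k → ℤ) :=
  ((graverBasis_finite (constraintMatrix k)).toFinset.filter fun g => ∑ S, g S < 0).toList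

theorem mem_descents {g : Clique k → ℤ} :
    g ∈ descents k ↔ g ∈ graverBasis (constraintMatrix k) ∧ ∑ S, g S < 0 := by
  simp [descents]

/-- The variant of the augmentation loop. -/
noncomputable def augmentVariant (s : Store (Var k)) : ℕ := ∑ S, s.reg (.sol S) + s.reg .flag

/-- Either some descent applies and the objective drops, or none does and the solution is optimal.
In the latter case the variant still drops, through its flag term. -/
theorem AugmentInv.step {x : Σ n, ICDH k n} {s : Store (Var k)} (h : AugmentInv x s)
    (hf : s.reg .flag ≠ 0) : AugmentInv x ((augmentCode (descents k)).run s) ∧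
      augmentVariant ((augmentCode (descents k)).run s) < augmentVariant s := by
  have hflag : s.reg .flag = 1 := by
    have := h.flag
    omega
  rcases run_augmentCode (descents k) s h.scan.tmp with ⟨h1, h2⟩ | ⟨g, hg, h1, h2, h3, h4⟩
  · rw [h2]
    have hr : ∀ y, y ≠ .flag → (s.setReg .flag 0).reg y = s.reg y := by
      intro y hy
      rw [Store.setReg_reg, if_neg hy]
    have hr0 : (s.setReg .flag 0).reg .flag = 0 := by rw [Store.setReg_reg, if_pos rfl]
    have hsol : solution (s.setReg .flag 0) = solution s := by
      ext S
      rw [solution, hr _ (by simp), solution]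
    refine ⟨⟨h.scan.congr fun y hy => hr y ?_, h.mem, ?_, ?_, h.link.congr fun i j => ?_, ?_, ?_,
      fun _ => ?_, fun v S => ⟨?_, ?_⟩⟩, ?_⟩
    · rintro rfl
      simp [Var.IsData] at hy
    · rw [hr0]; omega
    · rw [hr _ (by simp), h.next]
    · rw [hr _ (by simp)]
    · rw [hsol]; exact h.feasible
    · rw [hsol]; exact h.reach
    · rw [hsol]
      refine isOptimalSolution_of_forall_not_augments h.feasible ?_
      rintro c' ⟨g, hg, hneg, rfl, h0⟩
      exact h1 g (mem_descents.2 ⟨hg, hneg⟩) fun S => h0 S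
    · rw [hr _ (by simp), (h.free v S).1]
    · rw [hr _ (by simp), (h.free v S).2]
    · simp only [augmentVariant, hr0, hflag]
      have : ∀ S : Clique k, (s.setReg .flag 0).reg (.sol S) = s.reg (.sol S) :=
        fun S => hr _ (by simp)
      simp [this]
  · obtain ⟨hg, hneg⟩ := mem_descents.1 hg
    have hsol : solution ((augmentCode (descents k)).run s) = solution s + g := by
      ext S
      exact h3 S
    have haug : Augments (solution s) (solution ((augmentCode (descents k)).run s)) :=
      ⟨g, hg, hneg, hsol, fun S => by rw [hsol]; exact h1 S⟩
    have hfl : ((augmentCode (descents k)).run s).reg .flag = 1 := by rw [h4 _ (by simp), hflag]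
    refine ⟨⟨h.scan.congr fun y hy => h4 y fun S e => ?_, h2.trans h.mem, ?_, ?_,
      h.link.congr fun i j => ?_, haug.isFeasible h.feasible, h.reach.tail haug, ?_,
      fun v S => ⟨?_, ?_⟩⟩, ?_⟩
    · subst e
      simp [Var.IsData] at hy
    · rw [hfl]
    · rw [h4 _ (by simp), h.next]
    · rw [h4 _ (by simp)]
    · rw [hfl]; simp
    · rw [h4 _ (by simp), (h.free v S).1]
    · rw [h4 _ (by simp), (h.free v S).2]
    · have h5 : ∑ S, solution ((augmentCode (descents k)).run s) S < ∑ S, solution s S := by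
        rw [hsol]
        simp only [Pi.add_apply, Finset.sum_add_distrib]
        linarith
      simp only [solution] at h5
      simp only [augmentVariant, hfl, hflag]
      have h6 : ∑ S, ((augmentCode (descents k)).run s).reg (.sol S) < ∑ S, s.reg (.sol S) := by
        exact_mod_cast h5
      omega

/-! ### Third scan: the transmissions -/

/-- The first `m` users are served. -/
structure ServeInv (x : Σ n, ICDH k n) (m : ℕ) (s : Store (Var k)) : Prop where
  scan : Scan s x.1 m (2 * k * m)
  mem : ∀ p, m ≤ p → s.mem p = x.2.input.mem p
  mem_le : ∀ p, s.mem p ≤ 2 * (x.1 + 1)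
  flag : s.reg .flag ≤ 1
  link : LinksKnown x.2 s
  reach : Relation.ReflTransGen Augments x.2.initialSolution (solution s)
  optimal : x.2.IsOptimalSolution (solution s)
  progress : ∃ off : Clique k → ℕ, IsLayout off (fun S => s.reg (.sol S)) ∧
    x.2.Progress off (fun S => s.reg (.sol S)) m (fun v S => s.reg (.ptr v S))
      (fun v S => s.reg (.rem v S)) (s.reg .next) s.mem

/-- Lay out the transmissions, and begin the third scan. -/
noncomputable def layoutCode (k : ℕ) : Code (Var k) :=
  .seq (setupCode Finset.univ.toList) (startCode k)

theorem ServeInv.start {x : Σ n, ICDH k n} {s : Store (Var k)} (h : AugmentInv x s)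
    (hf : s.reg .flag = 0) : ServeInv x 0 ((layoutCode k).run s) := by
  obtain ⟨a1, a2, ⟨off, a3, a4, a5⟩, a6⟩ := run_setupCode (k := k) Finset.univ.toList
    (Finset.nodup_toList _) s h.scan.zero
  simp only [Finset.mem_toList, Finset.mem_univ, true_imp_iff, h.next, zero_add,
    Finset.sum_map_toList] at a2 a3 a4 a5 a6
  have hscan := h.scan.congr (s' := (setupCode Finset.univ.toList).run s) fun y hy =>
    a6 y (by rintro rfl; simp [Var.IsData] at hy) fun S v =>
      ⟨by rintro rfl; simp [Var.IsData] at hy, by rintro rfl; simp [Var.IsData] at hy⟩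
  obtain ⟨b1, b2, b3⟩ := run_startCode hscan.num hscan.zero hscan.tmp hscan.inC hscan.inS
  have hmem : ((layoutCode k).run s).mem = x.2.input.mem := (b2.trans a1).trans h.mem
  have hr : ∀ y : Var k, y.IsData → y ≠ .next → (∀ S v, y ≠ .ptr v S ∧ y ≠ .rem v S) →
      ((layoutCode k).run s).reg y = s.reg y := fun y hy h1 h2 => (b3 y hy).trans (a6 y h1 h2)
  have hsol : ∀ S, ((layoutCode k).run s).reg (.sol S) = s.reg (.sol S) := fun S =>
    hr _ (by simp [Var.IsData]) (by simp) (by simp)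
  have hsol' : solution ((layoutCode k).run s) = solution s := by
    ext S
    rw [solution, hsol, solution]
  refine ⟨b1, fun p _ => by rw [hmem], fun p => ?_, ?_, h.link.congr fun i j => ?_, ?_, ?_,
    off, ?_, ?_⟩
  · rw [hmem]
    exact (x.2.input_mem_le p).trans (by omega)
  · rw [hr _ (by simp [Var.IsData]) (by simp) (by simp)]
    exact h.flag
  · exact hr _ (by simp [Var.IsData]) (by simp) (by simp)
  · rw [hsol']
    exact h.reach
  · rw [hsol']
    exact h.optimal hf
  · simp only [hsol]
    exact ⟨a5, fun S => (a4 S).2⟩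
  · have h1 : (fun v S => ((layoutCode k).run s).reg (.ptr v S)) = fun _ => off := by
      ext v S
      exact (b3 _ (by simp [Var.IsData])).trans (a3 S v).1
    have h2 : (fun v S => ((layoutCode k).run s).reg (.rem v S)) = fun _ S => s.reg (.sol S) := by
      ext v S
      exact (b3 _ (by simp [Var.IsData])).trans (a3 S v).2
    have h3 : ((layoutCode k).run s).reg .next = ∑ S, s.reg (.sol S) :=
      (b3 _ (by simp [Var.IsData])).trans a2
    simp only [hsol]
    rw [h1, h2, h3]
    exact Progress.start h.feasible

open Classical in
/-- Serve a user. -/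
noncomputable def serveCode : Option (Category k) → Code (Var k)
  | none => .seq (.store .user .next) (.add .next .next .one)
  | some v => placeCode v (Finset.univ.filter fun S : Clique k => v ∈ S.1).toList

theorem run_placeCode_reg (v : Category k) (l : List (Clique k)) (s : Store (Var k)) (x : Var k)
    (h1 : ∀ S, x ≠ .ptr v S) (h2 : ∀ S, x ≠ .rem v S) :
    ((placeCode v l).run s).reg x = s.reg x := by
  induction l with
  | nil => rfl
  | cons S l ih =>
    simp only [placeCode, Code.run]
    split_ifs
    · simp [Store.setReg_reg, h1, h2]
    · exact ih

/-- Pointers and counters stay below the end of an interval, hence below `1ᵀc ≤ n`; the next free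
transmission adds at most `n` isolated users to this, and the `1` is for the flag. -/
theorem ServeInv.data_le {x : Σ n, ICDH k n} {m : ℕ} {s : Store (Var k)} (h : ServeInv x m s)
    (y : Var k) (hy : y.IsData) : s.reg y ≤ 2 * x.1 + 1 := by
  obtain ⟨off, hl, hp⟩ := h.progress
  have h1 : ∑ S, s.reg (.sol S) ≤ x.1 := by
    have := h.optimal.1.sum_le
    simp only [solution] at this
    exact_mod_cast this
  have h2 : ∀ S, s.reg (.sol S) ≤ ∑ S, s.reg (.sol S) := fun S =>
    Finset.single_le_sum (f := fun S => s.reg (.sol S)) (fun _ _ => Nat.zero_le _)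
      (Finset.mem_univ S)
  cases y <;> simp only [Var.IsData] at hy
  · have := h.flag
    omega
  · have h3 := hp.tc_eq
    have h4 := x.2.countBefore_le h.scan.le none
    have := h.scan.le
    omega
  · exact (h.link.le _ _).trans (by omega)
  · exact (h2 _).trans (by omega)
  · rename_i v S
    have := hp.ptr_add v S
    have := hl.le_sum S
    omega
  · rename_i v S
    have := hp.ptr_add v S
    have := hl.le_sum S
    omega

theorem ServeInv.step {x : Σ n, ICDH k n} {m : ℕ} {s : Store (Var k)} (h : ServeInv x m s)
    (hm : m < x.1) : ServeInv x (m + 1) ((scanBody serveCode).run s) := by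
  classical
  obtain ⟨s', a1, a2, a3, a4⟩ := run_scanBody x.2 serveCode h.scan hm h.mem h.link (by
    intro s' y hy
    cases x.2.userCategory ⟨m, hm⟩ with
    | none =>
      simp only [serveCode, Code.run, Store.setReg_reg]
      rw [if_neg]
      · rfl
      · rintro rfl
        simp [Var.IsData] at hy
    | some v =>
      refine run_placeCode_reg v _ s' y ?_ ?_
      all_goals
        rintro S rfl
        simp [Var.IsData] at hy)
  have hbound := h.data_le
  obtain ⟨off, hl, hp⟩ := h.progress
  cases hcat : x.2.userCategory ⟨m, hm⟩ with
  | none =>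
    rw [hcat] at a4
    have hnext : s'.reg .next = s.reg .next := a2.2 _ (by simp [Var.IsData])
    have hr : ∀ y : Var k, y.IsData → ((scanBody serveCode).run s).reg y =
        if y = .next then s.reg .next + 1 else s.reg y := by
      intro y hy
      rw [a4.2 y hy, ← a2.2 y hy]
      simp [serveCode, Code.run, Store.setReg_reg, hnext, a1.one]
    have hmem : ((scanBody serveCode).run s).mem = Function.update s.mem m (s.reg .next) := by
      rw [a4.1]
      simp [serveCode, Code.run, Store.setMem, hnext, a1.user, a2.1]
    have hsol : ∀ S, ((scanBody serveCode).run s).reg (.sol S) = s.reg (.sol S) := fun S => by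
      rw [hr _ (by simp [Var.IsData]), if_neg (by simp)]
    have hsol' : solution ((scanBody serveCode).run s) = solution s := by
      ext S
      rw [solution, hsol, solution]
    refine ⟨a3, fun p hp => ?_, fun p => ?_, ?_, h.link.congr fun i j => ?_, ?_, ?_, off, ?_, ?_⟩
    -- Cell `m` is lost to the output, but from now on the input is needed only from `m + 1` on.
    · rw [hmem, Function.update_of_ne (by omega), h.mem p (by omega)]
    · rw [hmem, Function.update_apply]
      split_ifs
      · exact (hbound _ (by simp [Var.IsData])).trans (by omega)
      · exact h.mem_le p
    · rw [hr _ (by simp [Var.IsData]), if_neg (by simp)]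
      exact h.flag
    · rw [hr _ (by simp [Var.IsData]), if_neg (by simp)]
    · rw [hsol']; exact h.reach
    · rw [hsol']; exact h.optimal
    · simp only [hsol]; exact hl
    · simp only [hsol, hmem]
      rw [hr .next (by simp [Var.IsData]), if_pos rfl]
      have := hp.step_none hm hcat
      convert this using 3
      all_goals rw [hr _ (by simp [Var.IsData]), if_neg (by simp)]
  | some v =>
    rw [hcat] at a4
    obtain ⟨S₀, hS₀, hrem₀⟩ := hp.exists_rem_ne_zero hm hcat
    obtain ⟨S, hS, hrem, hrun⟩ := run_placeCode v
      (Finset.univ.filter fun S : Clique k => v ∈ S.1).toList s' a1.one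
      ⟨S₀, by simpa using hS₀, by rwa [a2.2 _ (by simp [Var.IsData])]⟩
    rw [a2.2 _ (by simp [Var.IsData])] at hrem
    rw [serveCode, hrun] at a4
    simp only [a2.2 (.ptr v S) (by simp [Var.IsData]), a2.2 (.rem v S) (by simp [Var.IsData]),
      a1.user] at a4
    have hr : ∀ y : Var k, y.IsData → ((scanBody serveCode).run s).reg y =
        if y = .rem v S then s.reg (.rem v S) - 1 else
        if y = .ptr v S then s.reg (.ptr v S) + 1 else s.reg y := by
      intro y hy
      rw [a4.2 y hy, ← a2.2 y hy]
      simp [Store.setReg_reg]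
    have hmem : ((scanBody serveCode).run s).mem
        = Function.update s.mem m (s.reg (.ptr v S)) := by
      rw [a4.1, ← a2.1]
      rfl
    have hsol : ∀ S, ((scanBody serveCode).run s).reg (.sol S) = s.reg (.sol S) := fun S => by
      rw [hr _ (by simp [Var.IsData]), if_neg (by simp), if_neg (by simp)]
    have hsol' : solution ((scanBody serveCode).run s) = solution s := by
      ext S
      rw [solution, hsol, solution]
    refine ⟨a3, fun p hp => ?_, fun p => ?_, ?_, h.link.congr fun i j => ?_, ?_, ?_, off, ?_, ?_⟩
    · rw [hmem, Function.update_of_ne (by omega), h.mem p (by omega)]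
    · rw [hmem, Function.update_apply]
      split_ifs
      · exact (hbound _ (by simp [Var.IsData])).trans (by omega)
      · exact h.mem_le p
    · rw [hr _ (by simp [Var.IsData]), if_neg (by simp), if_neg (by simp)]
      exact h.flag
    · rw [hr _ (by simp [Var.IsData]), if_neg (by simp), if_neg (by simp)]
    · rw [hsol']; exact h.reach
    · rw [hsol']; exact h.optimal
    · simp only [hsol]; exact hl
    · simp only [hsol, hmem]
      rw [hr .next (by simp [Var.IsData]), if_neg (by simp), if_neg (by simp)]
      have := hp.step_some hl hm hcat (by simpa using hS) hrem
      convert this using 3 with w R w R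
      · rw [hr _ (by simp [Var.IsData]), if_neg (by simp)]
        simp only [Var.ptr.injEq]
        split_ifs with hw
        · rw [hw.1, hw.2]
        · rfl
      · rw [hr _ (by simp [Var.IsData])]
        simp only [Var.rem.injEq, reduceCtorEq, if_false]
        split_ifs with hw
        · rw [hw.1, hw.2]
        · rfl

/-! ### The output -/

/-- Needed because writing the solution of (IP) changes the memory from cell `n` on, where no user
has its entry. -/
theorem IsSchedule.congr {n : ℕ} {I : ICDH k n} {off c : Clique k → ℕ} {t : ℕ} {col col' : ℕ → ℕ}
    (h : I.IsSchedule off c t col) (hcol : ∀ u, u < n → col' u = col u) :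
    I.IsSchedule off c t col' where
  feasible := h.feasible
  disjoint := h.disjoint
  le_sum := h.le_sum
  length := h.length
  isolated u := by rw [hcol u u.2]; exact h.isolated u
  isolated_inj u u' := by rw [hcol u u.2, hcol u' u'.2]; exact h.isolated_inj u u'
  mem u := by rw [hcol u u.2]; exact h.mem u
  inj u u' := by rw [hcol u u.2, hcol u' u'.2]; exact h.inj u u'

/-- Write the solution behind the transmissions of the users, and the length to the output
register. -/
noncomputable def outputCode (e : Clique k ≃ Fin (Fintype.card (Clique k))) : Code (Var k) :=
  .seq (Code.stores .user .one ((List.ofFn e.symm).map .sol)) (.add .num .next .zero)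

/-- The output is correct. -/
def IsOutput (e : Clique k ≃ Fin (Fintype.card (Clique k))) (x : Σ n, ICDH k n)
    (s : Store (Var k)) : Prop :=
  ∃ off c : Clique k → ℕ, (∀ S, s.mem (x.1 + e S) = c S) ∧
    x.2.IsSchedule off c (s.reg .num) s.mem ∧
    (x.2.IsOptimalSolution fun S => (c S : ℤ)) ∧
    Relation.ReflTransGen Augments x.2.initialSolution fun S => (c S : ℤ)

theorem ServeInv.isOutput (e : Clique k ≃ Fin (Fintype.card (Clique k))) {x : Σ n, ICDH k n}
    {s : Store (Var k)} (h : ServeInv x x.1 s) : IsOutput e x ((outputCode e).run s) := by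
  obtain ⟨off, hl, hp⟩ := h.progress
  obtain ⟨h1, h2, h3⟩ := Code.run_stores (pos := Var.user) (one := Var.one) (by simp)
    ((List.ofFn e.symm).map .sol) (by simp) s h.scan.one
  -- After the last scan the user counter equals `n`, so it serves as the address of the first cell
  -- behind the transmissions.
  rw [h.scan.user] at h2 h3
  refine ⟨off, fun S => s.reg (.sol S), fun S => ?_, ?_, h.optimal, h.reach⟩
  · have := h3 (e S) (by simp)
    simp only [List.getElem_map, List.getElem_ofFn, Fin.eta, Equiv.symm_apply_apply] at this
    exact this
  · have hnum : ((outputCode e).run s).reg .num = s.reg .next := by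
      simp only [outputCode, Code.run, Store.setReg_reg, if_true]
      rw [h1 _ (by simp), h1 _ (by simp), h.scan.zero, add_zero]
    rw [hnum]
    exact (hp.isSchedule hl h.optimal.1).congr fun u hu => h2 u hu

/-! ### The program -/

theorem Scan.cnt_le {s : Store (Var k)} {n m p : ℕ} (h : Scan s n m p) : s.reg .cnt ≤ n := by
  rw [h.cnt]
  exact Nat.sub_le n m

theorem sol_le_of_isFeasible {n : ℕ} {I : ICDH k n} {s : Store (Var k)}
    (h : I.IsFeasible (solution s)) (S : Clique k) : s.reg (.sol S) ≤ n := by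
  have h1 : ∑ S, s.reg (.sol S) ≤ n := by
    have := h.sum_le
    simp only [solution] at this
    exact_mod_cast this
  exact (Finset.single_le_sum (f := fun S => s.reg (.sol S)) (fun _ _ => Nat.zero_le _)
    (Finset.mem_univ S)).trans h1

theorem LinkInv.bounded {x : Σ n, ICDH k n} {m : ℕ} {s : Store (Var k)} (h : LinkInv x m s) :
    s.Bounded ((2 * k + 2) * (x.1 + 1)) := by
  refine h.scan.bounded (fun y hy => ?_) fun p => ?_
  · cases y <;> simp only [Var.IsData] at hy
    · rw [h.flag]; omega
    · rw [h.next]; omega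
    · rw [h.link]; split_ifs <;> omega
    · rw [h.sol]; omega
    · rw [(h.free _ _).1]; omega
    · rw [(h.free _ _).2]; omega
  · rw [h.mem]
    exact (x.2.input_mem_le p).trans (by omega)

theorem CountInv.bounded {x : Σ n, ICDH k n} {m : ℕ} {s : Store (Var k)} (h : CountInv x m s) :
    s.Bounded ((2 * k + 2) * (x.1 + 1)) := by
  refine h.scan.bounded (fun y hy => ?_) fun p => ?_
  · cases y with
    | flag => rw [h.flag]; omega
    | next => rw [h.next]; omega
    | link i j => exact (h.link.le i j).trans (by omega)
    | sol S =>
      by_cases hS : ∃ v, S = singletonClique v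
      · obtain ⟨v, rfl⟩ := hS
        rw [h.sol]
        have := x.2.countBefore_le h.scan.le (some v)
        have := h.scan.le
        omega
      · push Not at hS
        rw [h.sol_zero S hS]
        omega
    | ptr v S => rw [(h.free v S).1]; omega
    | rem v S => rw [(h.free v S).2]; omega
    | _ => simp [Var.IsData] at hy
  · rw [h.mem]
    exact (x.2.input_mem_le p).trans (by omega)

theorem AugmentInv.bounded {x : Σ n, ICDH k n} {s : Store (Var k)} (h : AugmentInv x s) :
    s.Bounded ((2 * k + 2) * (x.1 + 1)) := by
  refine h.scan.bounded (fun y hy => ?_) fun p => ?_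
  · cases y with
    | flag => exact h.flag.trans (by omega)
    | next => rw [h.next]; omega
    | link i j => exact (h.link.le i j).trans (by omega)
    | sol S => exact (sol_le_of_isFeasible h.feasible S).trans (by omega)
    | ptr v S => rw [(h.free v S).1]; omega
    | rem v S => rw [(h.free v S).2]; omega
    | _ => simp [Var.IsData] at hy
  · rw [h.mem]
    exact (x.2.input_mem_le p).trans (by omega)

theorem ServeInv.bounded {x : Σ n, ICDH k n} {m : ℕ} {s : Store (Var k)} (h : ServeInv x m s) :
    s.Bounded ((2 * k + 2) * (x.1 + 1)) :=
  h.scan.bounded (fun y hy => (h.data_le y hy).trans (by omega)) h.mem_le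

theorem AugmentInv.variant_le {x : Σ n, ICDH k n} {s : Store (Var k)} (h : AugmentInv x s) :
    augmentVariant s ≤ x.1 + 1 := by
  have h1 : ∑ S, s.reg (.sol S) ≤ x.1 := by
    have := h.feasible.sum_le
    simp only [solution] at this
    exact_mod_cast this
  have := h.flag
  unfold augmentVariant
  omega

/-- A scan of the users with the invariant `p` takes quasilinear time. -/
theorem computes_scan {ρ : Var k → ℕ} (hρ : Function.Injective ρ) (P : Code (Var k))
    {p : (Σ n, ICDH k n) → ℕ → Store (Var k) → Prop}
    (hscan : ∀ x m s, p x m s → Scan s x.1 m (2 * k * m))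
    (hB : ∀ x m s, p x m s → s.Bounded ((2 * k + 2) * (x.1 + 1)))
    (hstep : ∀ x m s, p x m s → m < x.1 → p x (m + 1) (P.run s)) :
    Computes Sigma.fst ρ (.whileNonzero (ρ .cnt) (P.compile ρ)) (fun x s => p x 0 s)
      fun x s => p x x.1 s := by
  -- The number `m` of treated users is hidden in the loop invariant and recovered at the end: the
  -- variant `cnt` is `n - m`, and its vanishing gives `m = n`.
  refine (Computes.while hρ .cnt P (p := fun x s => ∃ m, p x m s) (2 * k + 2)
    (fun _ s => s.reg .cnt) ?_ ?_ ?_).weaken (fun x s h => ⟨0, h⟩) ?_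
  · rintro x s ⟨m, h⟩
    exact hB x m s h
  · rintro x s ⟨m, h⟩
    exact ((hscan x m s h).cnt_le).trans (Nat.le_succ _)
  · rintro x s ⟨m, h⟩ hc
    have hm := (hscan x m s h).lt hc
    have h' := hstep x m s h hm
    refine ⟨⟨m + 1, h'⟩, ?_⟩
    rw [(hscan x m s h).cnt, (hscan x _ _ h').cnt]
    omega
  · rintro x s ⟨⟨m, h⟩, hc⟩
    rwa [(hscan x m s h).eq hc] at h

/-- The whole program, given the registers of the variables. -/
noncomputable def program (e : Clique k ≃ Fin (Fintype.card (Clique k))) (ρ : Var k → ℕ) :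
    Program :=
  .seq ((startCode k).compile ρ) <|
  .seq (.whileNonzero (ρ .cnt) ((linkBody k).compile ρ)) <|
  .seq ((startCode k).compile ρ) <|
  .seq (.whileNonzero (ρ .cnt) ((scanBody countCode).compile ρ)) <|
  .seq ((Code.const .flag 1).compile ρ) <|
  .seq (.whileNonzero (ρ .flag) ((augmentCode (descents k)).compile ρ)) <|
  .seq ((layoutCode k).compile ρ) <|
  .seq (.whileNonzero (ρ .cnt) ((scanBody serveCode).compile ρ)) <|
  (outputCode e).compile ρ

theorem computes_program (e : Clique k ≃ Fin (Fintype.card (Clique k))) {ρ : Var k → ℕ}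
    (hρ : Function.Injective ρ) :
    Computes Sigma.fst ρ (program e ρ)
      (fun x s => s = ⟨fun v => if v = .num then x.1 else 0, x.2.input.mem⟩) (IsOutput e) := by
  refine (Computes.code hρ _ (q := fun x s => LinkInv x 0 s) (2 * k + 2) ?_ fun x s h =>
    LinkInv.start x h).seq ?_
  · rintro x s rfl
    have hle : x.1 + 1 ≤ (2 * k + 2) * (x.1 + 1) := Nat.le_mul_of_pos_left _ (by omega)
    refine ⟨fun v => ?_, fun p => (x.2.input_mem_le p).trans (by omega)⟩
    simp only
    split_ifs <;> omega
  refine (computes_scan hρ (linkBody k) (fun x m s h => h.scan) (fun x m s h => h.bounded)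
    fun x m s h hm => h.step hm).seq ?_
  refine (Computes.code hρ _ (q := fun x s => CountInv x 0 s) _ (fun x s h => h.bounded)
    fun x s h => CountInv.start h).seq ?_
  refine (computes_scan hρ (scanBody countCode) (fun x m s h => h.scan)
    (fun x m s h => h.bounded) fun x m s h hm => h.step hm).seq ?_
  refine (Computes.code hρ _ (q := AugmentInv) _ (fun x s h => h.bounded)
    fun x s h => AugmentInv.start h).seq ?_
  refine (Computes.while hρ .flag _ _ (fun _ s => augmentVariant s) (fun x s h => h.bounded)
    (fun x s h => h.variant_le) fun x s h hf => h.step hf).seq ?_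
  refine (Computes.code hρ _ (q := fun x s => ServeInv x 0 s) _ (fun x s h => h.1.bounded)
    fun x s h => ServeInv.start h.1 h.2).seq ?_
  refine (computes_scan hρ (scanBody serveCode) (fun x m s h => h.scan)
    (fun x m s h => h.bounded) fun x m s h hm => h.step hm).seq ?_
  exact Computes.code hρ _ _ (fun x s h => h.bounded) fun x s h => h.isOutput e

end ICDH

/-! ### The main theorem -/

theorem mainTheorem1 (k : ℕ) (e : ICDH.Clique k ≃ Fin (Fintype.card (ICDH.Clique k))) :
    ∃ (P : RAM.Program) (T : ℕ → ℕ),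
      (fun n : ℕ => (T n : ℝ)) =O[Filter.atTop] (fun n : ℕ => (n : ℝ) * Real.log n) ∧
      ∀ (n : ℕ) (I : ICDH k n), ∃ (out : RAM.State) (time : ℕ),
        RAM.Exec P I.input out time ∧ time ≤ T n ∧
        ∃ (t : ℕ) (col : ℕ → ℕ) (c : ICDH.Clique k → ℤ),
          -- the output: the length, the transmission of every user, the solution of the program
          t = out.reg 0 ∧ (∀ u, col u = out.mem u) ∧ (∀ S, c S = out.mem (n + e S)) ∧
          -- the scheme is an optimal XOR coloring scheme
          I.IsOptimalXORColoringScheme (ICDH.encodingMatrix n t col) ∧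
          -- the integer program is solved, by Graver basis augmentation
          I.IsOptimalSolution c ∧
          Relation.ReflTransGen ICDH.Augments I.initialSolution c ∧
          -- the scheme comes from the solution of the integer program
          (t : ℤ) = I.isolatedUsers.card + ∑ S, c S ∧
          ∀ S : ICDH.Clique k,
            c S = {i : Fin t | {v : ICDH.Category k | ∃ u : Fin n, col u = i ∧ I.InCategory u v}
              = (S.1 : Set (ICDH.Category k))}.ncard := by
  obtain ⟨ρ, hρ, h0⟩ := ICDH.exists_registers k
  obtain ⟨a, ha⟩ := ICDH.computes_program e hρ
  refine ⟨ICDH.program e ρ, fun n => a * ((n + 1) * RAM.bitCost n), RAM.isBigO_mul_bitCost a,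
    fun n I => ?_⟩
  obtain ⟨s, ⟨off, c, hc, hsched, hopt, hreach⟩, hrun⟩ := ha ⟨n, I⟩ _ rfl
  -- The input represents the initial store because `num` alone is kept in register `0`, the only
  -- register that may be nonzero at the start.
  obtain ⟨out, time, hexec, hrep, htime⟩ := hrun I.input ⟨fun v => by
    simp [ICDH.input, ← h0, hρ.eq_iff], rfl⟩
  refine ⟨out, time, hexec, htime, s.reg .num, s.mem, fun S => c S, ?_, ?_, ?_,
    hsched.isOptimalXORColoringScheme hopt, hopt, hreach, hsched.length_eq, ?_⟩
  · rw [← hrep.1, h0]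
  · intro u
    rw [hrep.2]
  · intro S
    rw [hrep.2, hc]
  · intro S
    rw [hsched.ncard_eq]
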